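/- Let $q_1,q_2\ge 0$ and consider the normal linear regression model $$y_t=x_t^{T}\beta_0+z_t^{T}\delta'+e_t,\qquad t=1,2,\dots,$$ where the pairs $(x_t,z_t)\in\mathbb R^{q_1}\times\mathbb R^{q_2}$ are i.i.d. with finite second moments, the errors $e_t$ are i.i.d. $\mathcal N(0,\sigma^2)$ with $\sigma^2>0$ and are independent of the regressors, and the parameter $\theta_0=(\beta_0^T,\delta'^T)^T$ is fixed, i.e. does not depend on $n$ (no local misspecification: $\delta'$ takes the place of $\delta/\sqrt n$). Write $u_t=(x_t^T,z_t^T)^T$ and assume that the Fisher information matrix $\sigma^{-2}\mathrm E(u_1u_1^T)$ is positive definite. Let $\mu(\theta)=a^T\beta+b^T\gamma$ be a linear focus parameter of $\theta=(\beta^T,\gamma^T)^T$ with $(a,b)\ne 0$. *Sub-models and estimators.* For $S\subset\{1,\dots,q_2\}$ let $\widehat\theta_S$ be a (measurable) maximum likelihood estimator of $\theta$ from $(x_t,z_t,y_t)_{t\le n}$ under the restriction $\gamma_j=0$ for $j\notin S$, let $\widehat\gamma_{full}$ be the $\gamma$-part of the estimator in the full model, and put $D_n=\sqrt n\,\widehat\gamma_{full}$.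 Let $S_1,\dots,S_M$ ($M\ge1$) be the candidate models and $w=(w_1,\dots,w_M)$ measurable random weights, which may depend on the data in any way (for instance $w_m=w_m(D_n)$), with $w_m\ge0$ and $\sum_m w_m=1$; in particular the S-AIC and S-BIC weights, proportional to $\exp(-\mathrm{AIC}_m/2)$ and $\exp(-\mathrm{BIC}_m/2)$, are allowed (with the likelihoods in $\mathrm{AIC}_m=-2l_n(\widehat\theta_{S_m})+2k_m$ and $\mathrm{BIC}_m=-2l_n(\widehat\theta_{S_m})+k_m\log n$, $k_m=q_1+|S_m|$, evaluated at the error variance $\widehat\sigma^2$ below). The model averaging estimator of the focus is $\widehat\mu=\sum_{m=1}^M w_m\,\mu(\widehat\theta_{S_m})$. *Plug-in quantities.* Let $\widehat\sigma^2$ be $\sigma^2$ itself (if it is known), or the maximum likelihood estimator $n^{-1}\sum_{t\le n}(y_t-u_t^T\widehat\theta_{full})^2$, or any measurable consistent estimator of $\sigma^2$. Partition the sample information matrix $$\widehat J=\frac1{n\widehat\sigma^2}\sum_{t=1}^n u_tu_t^T=\begin{pmatrix}\widehat J_{00}&\widehat J_{01}\\ \widehat J_{10}&\widehat J_{11}\end{pmatrix}$$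 according to $(\beta,\gamma)$, and put $\widehat K=(\widehat J_{11}-\widehat J_{10}\widehat J_{00}^{-1}\widehat J_{01})^{-1}$, $\widehat\omega=\widehat J_{10}\widehat J_{00}^{-1}a-b$, $\widehat\varphi=\{a^T\widehat J_{00}^{-1}a+\widehat\omega^T\widehat K\widehat\omega\}^{1/2}$. With $\Gamma_m$ the projection $\gamma\mapsto\gamma_{S_m}$, let $\widehat K_m=(\Gamma_m\widehat K^{-1}\Gamma_m^T)^{-1}$, $\widehat V_m=\widehat K^{-1/2}\Gamma_m^T\widehat K_m\Gamma_m\widehat K^{-1/2}$ and $$\widehat\delta(D)=\widehat K^{1/2}\Big\{\sum_{m=1}^M w_m\widehat V_m\Big\}\widehat K^{-1/2}D .$$ (These matrices are well defined with probability tending to one; on the exceptional event, where an inverse fails to exist, they are given an arbitrary fixed conventional value.) *Conclusion.* As $n\to\infty$, the studentised statistic of Hjort and Claeskens $$T_n=\frac{\sqrt n\{\widehat\mu-\mu(\theta_0)\}-\widehat\omega^T\{D_n-\widehat\delta(D_n)\}}{\widehat\varphi}$$ converges in distribution to $\mathcal N(0,1)$, and for every $\alpha\in(0,1)$ the confidence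 interval $$CI_n=\Big[\widehat\mu-\widehat\omega^T\{D_n-\widehat\delta(D_n)\}/\sqrt n-z_{1-\alpha/2}\widehat\varphi/\sqrt n,\ \ \widehat\mu-\widehat\omega^T\{D_n-\widehat\delta(D_n)\}/\sqrt n+z_{1-\alpha/2}\widehat\varphi/\sqrt n\Big],$$ where $z_{1-\alpha/2}$ is the $1-\alpha/2$ quantile of $\mathcal N(0,1)$, satisfies $\mathrm P\{\mu(\theta_0)\in CI_n\}\to1-\alpha$. -/

import Mathlib

open MeasureTheory ProbabilityTheory Filter Topology Matrix
open scoped NNReal ENNReal MatrixOrder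

noncomputable section

namespace FMA

/-- Parameters `θ = (β, γ)` (and regressors `(x, z)`) are indexed by the disjoint union of the
`q₁` core coordinates and the `q₂` additional coordinates. -/
abbrev Idx (q₁ q₂ : ℕ) : Type := Fin q₁ ⊕ Fin q₂

variable {q₁ q₂ : ℕ}

/-- The stacked regressors `u_t = (x_t, z_t)`, so that `u_t ⬝ᵥ θ = x_tᵀ β + z_tᵀ γ`. -/
def regressor (x : ℕ → Fin q₁ → ℝ) (z : ℕ → Fin q₂ → ℝ) (t : ℕ) : Idx q₁ q₂ → ℝ :=
  Sum.elim (x t) (z t)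

/-- The responses `y_t = x_tᵀ β + z_tᵀ γ + e_t`. -/
def response (u : ℕ → Idx q₁ q₂ → ℝ) (θ : Idx q₁ q₂ → ℝ) (e : ℕ → ℝ) (t : ℕ) : ℝ :=
  u t ⬝ᵥ θ + e t

/-- Fisher information `σ⁻² E[u uᵀ]` of one observation of the Gaussian linear model. -/
def fisherInfo {Ω : Type*} [MeasurableSpace Ω] (P : Measure Ω) (v : ℝ≥0)
    (U : Ω → Idx q₁ q₂ → ℝ) : Matrix (Idx q₁ q₂) (Idx q₁ q₂) ℝ :=
  Matrix.of fun i j => (v : ℝ)⁻¹ * ∫ ω, U ω i * U ω j ∂P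

/-- Log-likelihood of `θ` from the first `n` observations, with error variance `v`. -/
def logLik (v : ℝ≥0) (u : ℕ → Idx q₁ q₂ → ℝ) (y : ℕ → ℝ) (n : ℕ) (θ : Idx q₁ q₂ → ℝ) : ℝ :=
  ∑ t ∈ Finset.range n, Real.log (gaussianPDFReal (u t ⬝ᵥ θ) v (y t))

/-- The parameters of the sub-model `S`: `γ_j = 0` for `j ∉ S`. -/
def subModel (S : Finset (Fin q₂)) : Set (Idx q₁ q₂ → ℝ) :=
  {θ | ∀ j, j ∉ S → θ (Sum.inr j) = 0}

/-- `θ` is a maximum likelihood estimate in the sub-model `S`. (For every `v > 0` the maximisers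
are the same.) -/
def IsMLE (v : ℝ≥0) (u : ℕ → Idx q₁ q₂ → ℝ) (y : ℕ → ℝ) (n : ℕ) (S : Finset (Fin q₂))
    (θ : Idx q₁ q₂ → ℝ) : Prop :=
  θ ∈ subModel (q₁ := q₁) S ∧ IsMaxOn (logLik v u y n) (subModel S) θ

/-- The maximum likelihood estimate of the error variance, from the residuals at `θ`. -/
def residualVar (u : ℕ → Idx q₁ q₂ → ℝ) (y : ℕ → ℝ) (n : ℕ) (θ : Idx q₁ q₂ → ℝ) : ℝ≥0 :=
  Real.toNNReal ((∑ t ∈ Finset.range n, (y t - u t ⬝ᵥ θ) ^ 2) / n)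

/-- The sample information `Ĵ = -n⁻¹ ∑ ∂² log f / ∂θ ∂θᵀ = (n v)⁻¹ ∑ u_t u_tᵀ`. -/
def sampleInfo (v : ℝ≥0) (u : ℕ → Idx q₁ q₂ → ℝ) (n : ℕ) :
    Matrix (Idx q₁ q₂) (Idx q₁ q₂) ℝ :=
  ((n : ℝ) * v)⁻¹ • ∑ t ∈ Finset.range n, vecMulVec (u t) (u t)

/-- `K = (J₁₁ - J₁₀ J₀₀⁻¹ J₀₁)⁻¹`. -/
def matK (J : Matrix (Idx q₁ q₂) (Idx q₁ q₂) ℝ) : Matrix (Fin q₂) (Fin q₂) ℝ :=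
  (J.toBlocks₂₂ - J.toBlocks₂₁ * J.toBlocks₁₁⁻¹ * J.toBlocks₁₂)⁻¹

/-- `ω = J₁₀ J₀₀⁻¹ ∂μ/∂β - ∂μ/∂γ` for the linear focus parameter `μ(θ) = aᵀ β + bᵀ γ`. -/
def vecOmega (J : Matrix (Idx q₁ q₂) (Idx q₁ q₂) ℝ) (a : Fin q₁ → ℝ) (b : Fin q₂ → ℝ) :
    Fin q₂ → ℝ :=
  (J.toBlocks₂₁ * J.toBlocks₁₁⁻¹) *ᵥ a - b

/-- `φ = {(∂μ/∂β)ᵀ J₀₀⁻¹ ∂μ/∂β + ωᵀ K ω}^{1/2}`. -/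
def scalePhi (J : Matrix (Idx q₁ q₂) (Idx q₁ q₂) ℝ) (a : Fin q₁ → ℝ) (b : Fin q₂ → ℝ) : ℝ :=
  Real.sqrt (a ⬝ᵥ (J.toBlocks₁₁⁻¹ *ᵥ a) + vecOmega J a b ⬝ᵥ (matK J *ᵥ vecOmega J a b))

/-- The projection `Γ_S` sending `γ` to `γ_S`. -/
def projMat (S : Finset (Fin q₂)) : Matrix S (Fin q₂) ℝ :=
  (1 : Matrix (Fin q₂) (Fin q₂) ℝ).submatrix (fun i => (i : Fin q₂)) id

/-- `K_S = (Γ_S K⁻¹ Γ_Sᵀ)⁻¹`. -/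
def subK (K : Matrix (Fin q₂) (Fin q₂) ℝ) (S : Finset (Fin q₂)) : Matrix S S ℝ :=
  (projMat S * K⁻¹ * (projMat S)ᵀ)⁻¹

/-- `V_S = K^{-1/2} Γ_Sᵀ K_S Γ_S K^{-1/2}`. -/
def matV (K : Matrix (Fin q₂) (Fin q₂) ℝ) (S : Finset (Fin q₂)) : Matrix (Fin q₂) (Fin q₂) ℝ :=
  (CFC.sqrt K)⁻¹ * (projMat S)ᵀ * subK K S * projMat S * (CFC.sqrt K)⁻¹

/-- `δ̂(D) = K^{1/2} {∑_m w_m V_m} K^{-1/2} D`. -/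
def deltaHat {M : ℕ} (K : Matrix (Fin q₂) (Fin q₂) ℝ) (S : Fin M → Finset (Fin q₂))
    (w : Fin M → ℝ) (D : Fin q₂ → ℝ) : Fin q₂ → ℝ :=
  (CFC.sqrt K * (∑ m, w m • matV K (S m)) * (CFC.sqrt K)⁻¹) *ᵥ D

/-- The linear focus parameter `μ(θ) = aᵀ β + bᵀ γ`. -/
def focus (a : Fin q₁ → ℝ) (b : Fin q₂ → ℝ) (θ : Idx q₁ q₂ → ℝ) : ℝ :=
  a ⬝ᵥ (θ ∘ Sum.inl) + b ⬝ᵥ (θ ∘ Sum.inr)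

/-- The model averaging estimate `μ̂ = ∑_m w_m μ(θ̂_m)`; `est S` is the estimate of `θ` in the
sub-model `S`. -/
def avgFocus {M : ℕ} (a : Fin q₁ → ℝ) (b : Fin q₂ → ℝ) (S : Fin M → Finset (Fin q₂))
    (w : Fin M → ℝ) (est : Finset (Fin q₂) → Idx q₁ q₂ → ℝ) : ℝ :=
  ∑ m, w m * focus a b (est (S m))

/-- `D_n = √n γ̂_full`, with `γ̂_full` estimated in the full model. -/
def vecD (n : ℕ) (est : Finset (Fin q₂) → Idx q₁ q₂ → ℝ) : Fin q₂ → ℝ :=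
  Real.sqrt n • (est Finset.univ ∘ Sum.inr)

/-- The bias correction `ω̂ᵀ {D_n - δ̂(D_n)}`, all matrices being computed from the sample
information `J`. -/
def biasCorr {M : ℕ} (J : Matrix (Idx q₁ q₂) (Idx q₁ q₂) ℝ) (a : Fin q₁ → ℝ) (b : Fin q₂ → ℝ)
    (S : Fin M → Finset (Fin q₂)) (w : Fin M → ℝ) (n : ℕ)
    (est : Finset (Fin q₂) → Idx q₁ q₂ → ℝ) : ℝ :=
  vecOmega J a b ⬝ᵥ (vecD n est - deltaHat (matK J) S w (vecD n est))

/-- The studentised statistic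
`T_n = [√n {μ̂ - μ(θ₀)} - ω̂ᵀ {D_n - δ̂(D_n)}] / φ̂`. -/
def tStat {M : ℕ} (J : Matrix (Idx q₁ q₂) (Idx q₁ q₂) ℝ) (a : Fin q₁ → ℝ) (b : Fin q₂ → ℝ)
    (S : Fin M → Finset (Fin q₂)) (w : Fin M → ℝ) (n : ℕ)
    (est : Finset (Fin q₂) → Idx q₁ q₂ → ℝ) (θ₀ : Idx q₁ q₂ → ℝ) : ℝ :=
  (Real.sqrt n * (avgFocus a b S w est - focus a b θ₀) - biasCorr J a b S w n est)
    / scalePhi J a b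

/-- The `p`-quantile of the standard normal distribution. -/
def normalQuantile (p : ℝ) : ℝ := sInf {x : ℝ | p ≤ cdf (gaussianReal 0 1) x}

/-- The confidence interval with centre `μ̂ - ω̂ᵀ {D_n - δ̂(D_n)} / √n` and half-width
`z_{1-α/2} φ̂ / √n`. -/
def confInt {M : ℕ} (J : Matrix (Idx q₁ q₂) (Idx q₁ q₂) ℝ) (a : Fin q₁ → ℝ) (b : Fin q₂ → ℝ)
    (S : Fin M → Finset (Fin q₂)) (w : Fin M → ℝ) (n : ℕ)
    (est : Finset (Fin q₂) → Idx q₁ q₂ → ℝ) (α : ℝ) : Set ℝ :=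
  Set.Icc
    (avgFocus a b S w est - biasCorr J a b S w n est / Real.sqrt n
      - normalQuantile (1 - α / 2) * scalePhi J a b / Real.sqrt n)
    (avgFocus a b S w est - biasCorr J a b S w n est / Real.sqrt n
      + normalQuantile (1 - α / 2) * scalePhi J a b / Real.sqrt n)

/-- The score `-2 l_n(θ̂_S) + c k_S` with `k_S = q₁ + |S|`: AIC for `c = 2`, BIC for
`c = log n`. -/
def icScore (c : ℝ) (v : ℝ≥0) (u : ℕ → Idx q₁ q₂ → ℝ) (y : ℕ → ℝ) (n : ℕ)
    (est : Finset (Fin q₂) → Idx q₁ q₂ → ℝ) (S : Finset (Fin q₂)) : ℝ :=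
  -2 * logLik v u y n (est S) + c * ((q₁ : ℝ) + S.card)

/-- The smoothed information criterion weights
`w_m = exp(-IC_m / 2) / ∑_k exp(-IC_k / 2)`. -/
def icWeight {M : ℕ} (c : ℝ) (v : ℝ≥0) (u : ℕ → Idx q₁ q₂ → ℝ) (y : ℕ → ℝ) (n : ℕ)
    (est : Finset (Fin q₂) → Idx q₁ q₂ → ℝ) (S : Fin M → Finset (Fin q₂)) (m : Fin M) : ℝ :=
  Real.exp (-icScore c v u y n est (S m) / 2)
    / ∑ k, Real.exp (-icScore c v u y n est (S k) / 2)

end FMA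

end

/-! The bias correction is exact and not merely asymptotic. Write `l = (a, b)` and `G = ∑ u_t u_tᵀ`.
The normal equations say that `G (θ̂_S - θ̂_full)` is orthogonal to the sub-model `S`. Block
elimination turns this into `γ̂_S = Γ_Sᵀ K_S Γ_S K⁻¹ γ̂_full` and `μ(θ̂_S) - μ(θ̂_full) = ωᵀ
(γ̂_full - γ̂_S)` (`focus_restricted`). Averaging with weights of sum one produces exactly `ω̂ᵀ {D_n
- δ̂(D_n)} / √n` (`avgFocus_sub_biasCorr`). The weights and candidate models therefore cancel, and
the numerator of `T_n` is `√n {μ(θ̂_full) - μ(θ₀)}`, however the weights depend on the data and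
whatever the fixed parameter is.

The scale satisfies `φ̂² = lᵀ Ĵ⁻¹ l` (`scalePhi_eq`). Hence `T_n = σ̂⁻¹ ∑ c_t e_t`, where the `c_t`
depend on the regressors only and `∑ c_t² = 1` (`tStat_eq`, `sum_errorCoef_sq`). Given the
regressors, `σ⁻¹ ∑ c_t e_t` is exactly standard normal whenever `G` is positive definite.
`charFun_map_sum_mul` expresses this through characteristic functions, and
`tendstoInDistribution_errorCoef` passes to the limit, `G` being almost surely positive definite
from some `n` on. Slutsky's lemma replaces `σ` by `σ̂`. Coverage follows from the portmanteau
theorem, since `μ(θ₀) ∈ CI_n` means `|T_n| ≤ z_{1-α/2}`.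

These identities need `n > 0`, `G` positive definite, `σ̂² > 0` and the maximum likelihood property.
The event where one of these fails has vanishing probability. -/

namespace FMA

/-! ### Block matrix algebra: Schur complements, the scale and restricted estimates -/

section LinearAlgebra

variable {q₁ q₂ : ℕ}

/-- The Schur complement `J₁₁ - J₁₀ J₀₀⁻¹ J₀₁`. -/
noncomputable def schur (J : Matrix (Idx q₁ q₂) (Idx q₁ q₂) ℝ) : Matrix (Fin q₂) (Fin q₂) ℝ :=
  J.toBlocks₂₂ - J.toBlocks₂₁ * J.toBlocks₁₁⁻¹ * J.toBlocks₁₂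

lemma matK_eq_schur_inv (J : Matrix (Idx q₁ q₂) (Idx q₁ q₂) ℝ) : matK J = (schur J)⁻¹ := rfl

lemma transpose_toBlocks₁₂ {J : Matrix (Idx q₁ q₂) (Idx q₁ q₂) ℝ} (hJ : J.IsHermitian) :
    J.toBlocks₁₂ᵀ = J.toBlocks₂₁ := by
  ext i j
  have := hJ.apply (Sum.inr i) (Sum.inl j)
  simpa [toBlocks₁₂, toBlocks₂₁] using this

lemma toBlocks₁₁_posSemidef {J : Matrix (Idx q₁ q₂) (Idx q₁ q₂) ℝ} (hJ : J.PosSemidef) :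
    J.toBlocks₁₁.PosSemidef := hJ.submatrix Sum.inl

lemma toBlocks₁₁_posDef {J : Matrix (Idx q₁ q₂) (Idx q₁ q₂) ℝ} (hJ : J.PosDef) :
    J.toBlocks₁₁.PosDef := hJ.submatrix Sum.inl_injective

/-- Invertibility of the block `J₀₀` is not needed: if it is singular, its inverse is zero by
convention and the Schur complement is just `J₁₁`. This generality serves the measurability of `T_n`
on the whole sample space. -/
lemma schur_posSemidef {J : Matrix (Idx q₁ q₂) (Idx q₁ q₂) ℝ} (hJ : J.PosSemidef) :
    (schur J).PosSemidef := by
  by_cases h : IsUnit J.toBlocks₁₁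
  · have hA : J.toBlocks₁₁.PosDef := (toBlocks₁₁_posSemidef hJ).posDef_iff_isUnit.2 h
    have := h.invertible
    have hC : J.toBlocks₁₂ᴴ = J.toBlocks₂₁ := by
      rw [conjTranspose_eq_transpose_of_trivial, transpose_toBlocks₁₂ hJ.1]
    have key := (PosDef.fromBlocks₁₁ J.toBlocks₁₂ J.toBlocks₂₂ hA).1
    rw [hC, fromBlocks_toBlocks] at key
    exact key hJ
  · have h0 : J.toBlocks₁₁⁻¹ = 0 :=
      nonsing_inv_apply_not_isUnit _ (by rwa [isUnit_iff_isUnit_det] at h)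
    have : schur J = J.toBlocks₂₂ := by simp [schur, h0]
    rw [this]
    exact hJ.submatrix Sum.inr

lemma schur_posDef {J : Matrix (Idx q₁ q₂) (Idx q₁ q₂) ℝ} (hJ : J.PosDef) :
    (schur J).PosDef := by
  rw [(schur_posSemidef hJ.posSemidef).posDef_iff_isUnit, isUnit_iff_isUnit_det]
  have := (toBlocks₁₁_posDef hJ).isUnit.invertible
  have h := det_fromBlocks₁₁ J.toBlocks₁₁ J.toBlocks₁₂ J.toBlocks₂₁ J.toBlocks₂₂
  rw [fromBlocks_toBlocks, invOf_eq_nonsing_inv] at h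
  have hu := (isUnit_iff_isUnit_det _).1 hJ.isUnit
  rw [h] at hu
  exact isUnit_of_mul_isUnit_right hu

/-- The matrix `Γ_Sᵀ K_S Γ_S K⁻¹`, which maps the full to the restricted estimate of `γ`. -/
noncomputable def shrinkMat (K : Matrix (Fin q₂) (Fin q₂) ℝ) (S : Finset (Fin q₂)) :
    Matrix (Fin q₂) (Fin q₂) ℝ :=
  (projMat S)ᵀ * subK K S * projMat S * K⁻¹

/-- The outer factors `K^{1/2}` and `K^{-1/2}` combine with those inside `V_m`, so no square root
survives. -/
lemma deltaHat_eq_of_isUnit {M : ℕ} {K : Matrix (Fin q₂) (Fin q₂) ℝ} (hK : K.PosSemidef)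
    (hu : IsUnit K) (S : Fin M → Finset (Fin q₂)) (w : Fin M → ℝ) (D : Fin q₂ → ℝ) :
    deltaHat K S w D = (∑ m, w m • shrinkMat K (S m)) *ᵥ D := by
  have hn : 0 ≤ K := hK.nonneg
  have hs : CFC.sqrt K * CFC.sqrt K = K := CFC.sqrt_mul_sqrt_self K hn
  have hsu : IsUnit (CFC.sqrt K).det :=
    (isUnit_iff_isUnit_det _).1 ((CFC.isUnit_sqrt_iff K hn).2 hu)
  have hinv : (CFC.sqrt K)⁻¹ * (CFC.sqrt K)⁻¹ = K⁻¹ := by rw [← Matrix.mul_inv_rev, hs]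
  unfold deltaHat
  congr 1
  rw [Finset.mul_sum, Finset.sum_mul]
  refine Finset.sum_congr rfl fun m _ => ?_
  rw [mul_smul_comm, smul_mul_assoc]
  congr 1
  simp only [matV, shrinkMat, ← hinv, Matrix.mul_assoc]
  rw [mul_nonsing_inv_cancel_left _ _ hsu]

/-- If `matK J` is singular, it is zero by the convention for inverses, and both sides vanish.
Matrix square roots are thus eliminated at every sample point, so their measurability is never an
issue. -/
lemma deltaHat_matK {M : ℕ} {J : Matrix (Idx q₁ q₂) (Idx q₁ q₂) ℝ} (hJ : J.PosSemidef)
    (S : Fin M → Finset (Fin q₂)) (w : Fin M → ℝ) (D : Fin q₂ → ℝ) :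
    deltaHat (matK J) S w D = (∑ m, w m • shrinkMat (matK J) (S m)) *ᵥ D := by
  by_cases hu : IsUnit (matK J)
  · exact deltaHat_eq_of_isUnit (schur_posSemidef hJ).inv hu S w D
  · have h0 : matK J = 0 := by
      rw [matK_eq_schur_inv] at hu ⊢
      refine nonsing_inv_apply_not_isUnit _ fun h => hu ?_
      rw [isUnit_iff_isUnit_det]
      exact isUnit_nonsing_inv_det _ h
    simp [deltaHat, shrinkMat, h0]

lemma focus_eq_dotProduct (a : Fin q₁ → ℝ) (b : Fin q₂ → ℝ) (θ : Idx q₁ q₂ → ℝ) :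
    focus a b θ = Sum.elim a b ⬝ᵥ θ := by
  conv_rhs => rw [← Sum.elim_comp_inl_inr θ]
  rw [sumElim_dotProduct_sumElim, focus]

/-- The square of the scale `φ` is the quadratic form of `J⁻¹` at the gradient of the focus. -/
lemma scalePhi_eq {J : Matrix (Idx q₁ q₂) (Idx q₁ q₂) ℝ} (hJ : J.PosDef)
    (a : Fin q₁ → ℝ) (b : Fin q₂ → ℝ) :
    scalePhi J a b = Real.sqrt (Sum.elim a b ⬝ᵥ (J⁻¹ *ᵥ Sum.elim a b)) := by
  have hA : IsUnit J.toBlocks₁₁.det := (isUnit_iff_isUnit_det _).1 (toBlocks₁₁_posDef hJ).isUnit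
  have hX : IsUnit (schur J).det := (isUnit_iff_isUnit_det _).1 (schur_posDef hJ).isUnit
  have hJu : IsUnit J.det := (isUnit_iff_isUnit_det _).1 hJ.isUnit
  have hBC := transpose_toBlocks₁₂ hJ.1
  have hAt : J.toBlocks₁₁⁻¹ᵀ = J.toBlocks₁₁⁻¹ := by
    have := (toBlocks₁₁_posDef hJ).inv.1
    rwa [IsHermitian, conjTranspose_eq_transpose_of_trivial] at this
  -- Block elimination in `J v = (a, b)`: the lower part of the solution is `-K ω`, and the upper
  -- part follows from the first block row.
  set ν : Fin q₂ → ℝ := matK J *ᵥ vecOmega J a b with hν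
  set v : Idx q₁ q₂ → ℝ := Sum.elim (J.toBlocks₁₁⁻¹ *ᵥ (a + J.toBlocks₁₂ *ᵥ ν)) (-ν) with hv
  have hXν : schur J *ᵥ ν = vecOmega J a b := by
    rw [hν, mulVec_mulVec, matK_eq_schur_inv, mul_nonsing_inv _ hX, one_mulVec]
  have hJv : J *ᵥ v = Sum.elim a b := by
    have hmul : J *ᵥ v = fromBlocks J.toBlocks₁₁ J.toBlocks₁₂ J.toBlocks₂₁ J.toBlocks₂₂ *ᵥ v := by
      rw [fromBlocks_toBlocks]
    rw [hmul, fromBlocks_mulVec, hv]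
    congr 1
    · simp only [Sum.elim_comp_inl, Sum.elim_comp_inr]
      rw [mulVec_mulVec, mul_nonsing_inv _ hA, one_mulVec, mulVec_neg]
      abel
    · simp only [Sum.elim_comp_inl, Sum.elim_comp_inr]
      have : b = (J.toBlocks₂₁ * J.toBlocks₁₁⁻¹) *ᵥ a - schur J *ᵥ ν := by
        rw [hXν, vecOmega]; abel
      rw [this, schur, mulVec_mulVec, mulVec_add, mulVec_neg, sub_mulVec, mulVec_mulVec]
      abel
  have hinv : J⁻¹ *ᵥ Sum.elim a b = v := by
    rw [← hJv, mulVec_mulVec, nonsing_inv_mul _ hJu, one_mulVec]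
  rw [scalePhi, hinv, hv, sumElim_dotProduct_sumElim, mulVec_add, dotProduct_add, ← hν]
  congr 1
  have h1 : a ⬝ᵥ J.toBlocks₁₁⁻¹ *ᵥ J.toBlocks₁₂ *ᵥ ν
      = ((J.toBlocks₂₁ * J.toBlocks₁₁⁻¹) *ᵥ a) ⬝ᵥ ν := by
    rw [mulVec_mulVec, dotProduct_mulVec, ← mulVec_transpose, transpose_mul, hBC, hAt]
  rw [h1, vecOmega, sub_dotProduct, dotProduct_neg]
  ring

/-- The focus at the restricted estimate, in terms of the full estimate. -/
lemma focus_restricted {J : Matrix (Idx q₁ q₂) (Idx q₁ q₂) ℝ} (hJ : J.PosDef)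
    (a : Fin q₁ → ℝ) (b : Fin q₂ → ℝ) (S : Finset (Fin q₂)) {θ θf : Idx q₁ q₂ → ℝ}
    (hθ : θ ∈ subModel S) (horth : ∀ h ∈ subModel S, h ⬝ᵥ (J *ᵥ (θ - θf)) = 0) :
    focus a b θ = focus a b θf + vecOmega J a b ⬝ᵥ
      (θf ∘ Sum.inr - shrinkMat (matK J) S *ᵥ (θf ∘ Sum.inr)) := by
  have hA : IsUnit J.toBlocks₁₁.det := (isUnit_iff_isUnit_det _).1 (toBlocks₁₁_posDef hJ).isUnit
  have hXp := schur_posDef hJ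
  have hX : IsUnit (schur J).det := (isUnit_iff_isUnit_det _).1 hXp.isUnit
  have hBC := transpose_toBlocks₁₂ hJ.1
  have hAt : J.toBlocks₁₁⁻¹ᵀ = J.toBlocks₁₁⁻¹ := by
    have := (toBlocks₁₁_posDef hJ).inv.1
    rwa [IsHermitian, conjTranspose_eq_transpose_of_trivial] at this
  obtain ⟨dβ, dγ, hd⟩ : ∃ dβ dγ, θ - θf = Sum.elim dβ dγ :=
    ⟨(θ - θf) ∘ Sum.inl, (θ - θf) ∘ Sum.inr, (Sum.elim_comp_inl_inr _).symm⟩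
  have hJd : J *ᵥ (θ - θf) = Sum.elim (J.toBlocks₁₁ *ᵥ dβ + J.toBlocks₁₂ *ᵥ dγ)
      (J.toBlocks₂₁ *ᵥ dβ + J.toBlocks₂₂ *ᵥ dγ) := by
    conv_lhs => rw [← fromBlocks_toBlocks J]
    rw [hd, fromBlocks_mulVec]
    simp only [Sum.elim_comp_inl, Sum.elim_comp_inr]
  -- Directions that move only `β` are unrestricted, so the upper block of `J (θ - θf)` vanishes and
  -- `dβ` is determined by `dγ`.
  have hβ : J.toBlocks₁₁ *ᵥ dβ + J.toBlocks₁₂ *ᵥ dγ = 0 := by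
    refine dotProduct_eq_zero _ fun k => ?_
    have := horth (Sum.elim k 0) fun j _ => rfl
    rw [hJd, sumElim_dotProduct_sumElim, zero_dotProduct, add_zero] at this
    rw [dotProduct_comm, this]
  have hdβ : dβ = -(J.toBlocks₁₁⁻¹ *ᵥ (J.toBlocks₁₂ *ᵥ dγ)) := by
    rw [← mulVec_neg, ← eq_neg_of_add_eq_zero_left hβ, mulVec_mulVec, nonsing_inv_mul _ hA,
      one_mulVec]
  have hlow : J.toBlocks₂₁ *ᵥ dβ + J.toBlocks₂₂ *ᵥ dγ = schur J *ᵥ dγ := by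
    rw [hdβ, schur, sub_mulVec, mulVec_neg, mulVec_mulVec, mulVec_mulVec, Matrix.mul_assoc]
    abel
  have hproj : ∀ v : Fin q₂ → ℝ, projMat S *ᵥ v = fun i : S => v i := by
    intro v
    funext i
    simp [projMat, mulVec, dotProduct, Matrix.one_apply]
  -- Testing with the coordinate directions in `S` gives the remaining equations, now in terms of
  -- `dγ` alone.
  have hγ : projMat S *ᵥ (schur J *ᵥ dγ) = 0 := by
    rw [hproj]
    funext i
    have := horth (Sum.elim 0 (Pi.single (i : Fin q₂) 1)) fun j hj => by
      have : j ≠ i := fun h => hj (h ▸ i.2)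
      simp [this]
    rw [hJd, sumElim_dotProduct_sumElim, zero_dotProduct, zero_add, hlow] at this
    simpa using this
  have hpt : (projMat S)ᵀ *ᵥ (projMat S *ᵥ (θ ∘ Sum.inr)) = θ ∘ Sum.inr := by
    rw [hproj]
    funext j
    simp only [mulVec, dotProduct, transpose_apply, projMat, submatrix_apply, id, one_apply,
      Function.comp, ite_mul, one_mul, zero_mul]
    by_cases hj : j ∈ S
    · rw [Finset.sum_eq_single ⟨j, hj⟩]
      · simp
      · intro i _ hi
        rw [if_neg fun h => hi (Subtype.ext h)]
      · simp
    · rw [hθ j hj]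
      refine Finset.sum_eq_zero fun i _ => if_neg fun h => hj ?_
      exact (show (i : Fin q₂) = j from h) ▸ i.2
  have hKi : (matK J)⁻¹ = schur J := by
    rw [matK_eq_schur_inv, nonsing_inv_nonsing_inv _ hX]
  have hsub : IsUnit (projMat S * schur J * (projMat S)ᵀ).det := by
    rw [← isUnit_iff_isUnit_det]
    have : projMat S * schur J * (projMat S)ᵀ
        = (schur J).submatrix (fun i : S => (i : Fin q₂)) (fun i : S => (i : Fin q₂)) := by
      ext i j
      simp [projMat, mul_apply, one_apply]
    rw [this]
    exact (hXp.submatrix Subtype.val_injective).isUnit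
  have hdγ : dγ = θ ∘ Sum.inr - θf ∘ Sum.inr := by
    funext j
    exact (congrFun hd (Sum.inr j)).symm
  have hdβ' : dβ = θ ∘ Sum.inl - θf ∘ Sum.inl := by
    funext j
    exact (congrFun hd (Sum.inl j)).symm
  -- Since `γ = Γᵀ Γ γ` in the sub-model, `Γ K⁻¹ dγ = 0` reads `Γ K⁻¹ γf = (Γ K⁻¹ Γᵀ) Γ γ`; it
  -- remains to invert the matrix on the right.
  have hshrink : shrinkMat (matK J) S *ᵥ (θf ∘ Sum.inr) = θ ∘ Sum.inr := by
    have h1 : projMat S *ᵥ (schur J *ᵥ (θf ∘ Sum.inr))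
        = (projMat S * schur J * (projMat S)ᵀ) *ᵥ (projMat S *ᵥ (θ ∘ Sum.inr)) := by
      rw [hdγ, mulVec_sub, mulVec_sub, sub_eq_zero] at hγ
      rw [← hγ, ← mulVec_mulVec (projMat S *ᵥ (θ ∘ Sum.inr)), hpt, ← mulVec_mulVec]
    rw [shrinkMat, subK, hKi, ← mulVec_mulVec, ← mulVec_mulVec, ← mulVec_mulVec, h1,
      mulVec_mulVec _ _⁻¹, nonsing_inv_mul _ hsub, one_mulVec, hpt]
  rw [hshrink]
  have h1 : a ⬝ᵥ dβ = -(((J.toBlocks₂₁ * J.toBlocks₁₁⁻¹) *ᵥ a) ⬝ᵥ dγ) := by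
    rw [hdβ, dotProduct_neg, mulVec_mulVec, dotProduct_mulVec, ← mulVec_transpose, transpose_mul,
      hBC, hAt]
  have h2 : focus a b θ - focus a b θf = a ⬝ᵥ dβ + b ⬝ᵥ dγ := by
    rw [hdγ, hdβ', dotProduct_sub, dotProduct_sub, focus, focus]
    ring
  have h3 : θf ∘ Sum.inr - θ ∘ Sum.inr = -dγ := by rw [hdγ]; abel
  rw [h3, vecOmega, dotProduct_neg, sub_dotProduct]
  linarith

end LinearAlgebra

/-! ### Normal equations and the exact form of the studentised statistic -/

section LeastSquares

variable {q₁ q₂ : ℕ}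

/-- The Gram matrix `∑_{t < n} u_t u_tᵀ`. -/
def gram (u : ℕ → Idx q₁ q₂ → ℝ) (n : ℕ) : Matrix (Idx q₁ q₂) (Idx q₁ q₂) ℝ :=
  ∑ t ∈ Finset.range n, vecMulVec (u t) (u t)

/-- The vector `∑_{t < n} e_t u_t`. -/
def errorSum (u : ℕ → Idx q₁ q₂ → ℝ) (e : ℕ → ℝ) (n : ℕ) : Idx q₁ q₂ → ℝ :=
  ∑ t ∈ Finset.range n, e t • u t

/-- The coefficient of `e_t` in the error of the full least squares estimate of `ℓ ⬝ᵥ θ`,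
standardised to unit length. -/
noncomputable def errorCoef (l : Idx q₁ q₂ → ℝ) (u : ℕ → Idx q₁ q₂ → ℝ) (n t : ℕ) : ℝ :=
  (l ⬝ᵥ ((gram u n)⁻¹ *ᵥ u t)) / Real.sqrt (l ⬝ᵥ ((gram u n)⁻¹ *ᵥ l))

lemma gram_posSemidef (u : ℕ → Idx q₁ q₂ → ℝ) (n : ℕ) : (gram u n).PosSemidef := by
  refine posSemidef_sum _ fun t _ => ?_
  simpa using posSemidef_vecMulVec_self_star (u t)

lemma gram_mulVec (u : ℕ → Idx q₁ q₂ → ℝ) (n : ℕ) (v : Idx q₁ q₂ → ℝ) :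
    gram u n *ᵥ v = ∑ t ∈ Finset.range n, (u t ⬝ᵥ v) • u t := by
  rw [gram, sum_mulVec]
  refine Finset.sum_congr rfl fun t _ => ?_
  rw [vecMulVec_mulVec]
  simp

lemma dotProduct_gram_mulVec (u : ℕ → Idx q₁ q₂ → ℝ) (n : ℕ) (v w : Idx q₁ q₂ → ℝ) :
    v ⬝ᵥ (gram u n *ᵥ w) = ∑ t ∈ Finset.range n, (u t ⬝ᵥ v) * (u t ⬝ᵥ w) := by
  rw [gram_mulVec, dotProduct_sum]
  refine Finset.sum_congr rfl fun t _ => ?_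
  rw [dotProduct_smul, smul_eq_mul, dotProduct_comm v, mul_comm]

lemma dotProduct_errorSum (u : ℕ → Idx q₁ q₂ → ℝ) (e : ℕ → ℝ) (n : ℕ) (v : Idx q₁ q₂ → ℝ) :
    v ⬝ᵥ errorSum u e n = ∑ t ∈ Finset.range n, e t * (u t ⬝ᵥ v) := by
  rw [errorSum, dotProduct_sum]
  refine Finset.sum_congr rfl fun t _ => ?_
  rw [dotProduct_smul, smul_eq_mul, dotProduct_comm v]

lemma sampleInfo_eq (v : ℝ≥0) (u : ℕ → Idx q₁ q₂ → ℝ) (n : ℕ) :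
    sampleInfo v u n = ((n : ℝ) * v)⁻¹ • gram u n := rfl

lemma sampleInfo_posSemidef (v : ℝ≥0) (u : ℕ → Idx q₁ q₂ → ℝ) (n : ℕ) :
    (sampleInfo v u n).PosSemidef :=
  (gram_posSemidef u n).smul (by positivity)

/-- The discriminant `4 B²` cannot be positive. With `τ` as step length, this is the first order
condition at a minimum of the sum of squares. -/
lemma eq_zero_of_quadratic_nonneg {B C : ℝ} (h : ∀ τ : ℝ, 0 ≤ C * τ ^ 2 - 2 * B * τ) : B = 0 := by
  have hd := discrim_le_zero (a := C) (b := -2 * B) (c := 0) fun τ => by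
    have := h τ
    nlinarith
  rw [discrim] at hd
  nlinarith [sq_nonneg B]

lemma logLik_eq {v : ℝ≥0} (hv : 0 < v) (u : ℕ → Idx q₁ q₂ → ℝ) (y : ℕ → ℝ) (n : ℕ)
    (θ : Idx q₁ q₂ → ℝ) :
    logLik v u y n θ = n * Real.log (√(2 * Real.pi * v))⁻¹
      - (∑ t ∈ Finset.range n, (y t - u t ⬝ᵥ θ) ^ 2) / (2 * v) := by
  have hv' : (0 : ℝ) < v := hv
  have : ∀ t, Real.log (gaussianPDFReal (u t ⬝ᵥ θ) v (y t))
      = Real.log (√(2 * Real.pi * v))⁻¹ - (y t - u t ⬝ᵥ θ) ^ 2 / (2 * v) := by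
    intro t
    rw [gaussianPDFReal, Real.log_mul (by positivity) (Real.exp_ne_zero _), Real.log_exp]
    ring
  simp only [logLik, this, Finset.sum_sub_distrib, Finset.sum_const, Finset.card_range,
    nsmul_eq_mul, Finset.sum_div]

/-- The normal equations of a maximum likelihood estimate. -/
lemma IsMLE.normal_eq {v : ℝ≥0} (hv : 0 < v) {u : ℕ → Idx q₁ q₂ → ℝ} {y : ℕ → ℝ} {n : ℕ}
    {S : Finset (Fin q₂)} {θ : Idx q₁ q₂ → ℝ} (hθ : IsMLE v u y n S θ) {h : Idx q₁ q₂ → ℝ}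
    (hh : h ∈ subModel (q₁ := q₁) S) :
    ∑ t ∈ Finset.range n, (y t - u t ⬝ᵥ θ) * (u t ⬝ᵥ h) = 0 := by
  have hv' : (0 : ℝ) < v := hv
  refine eq_zero_of_quadratic_nonneg (C := ∑ t ∈ Finset.range n, (u t ⬝ᵥ h) ^ 2) fun τ => ?_
  have hmem : θ + τ • h ∈ subModel (q₁ := q₁) S := fun j hj => by
    simp [hθ.1 j hj, hh j hj]
  have hle : logLik v u y n (θ + τ • h) ≤ logLik v u y n θ := hθ.2 hmem
  rw [logLik_eq hv, logLik_eq hv, sub_le_sub_iff_left,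
    div_le_div_iff_of_pos_right (by positivity)] at hle
  have hexp : ∑ t ∈ Finset.range n, (y t - u t ⬝ᵥ (θ + τ • h)) ^ 2
      = ∑ t ∈ Finset.range n, (y t - u t ⬝ᵥ θ) ^ 2
        + ((∑ t ∈ Finset.range n, (u t ⬝ᵥ h) ^ 2) * τ ^ 2
          - 2 * (∑ t ∈ Finset.range n, (y t - u t ⬝ᵥ θ) * (u t ⬝ᵥ h)) * τ) := by
    rw [Finset.mul_sum, Finset.sum_mul, Finset.sum_mul, ← Finset.sum_sub_distrib,
      ← Finset.sum_add_distrib]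
    refine Finset.sum_congr rfl fun t _ => ?_
    rw [dotProduct_add, dotProduct_smul, smul_eq_mul]
    ring
  linarith

variable {v : ℝ≥0} {u : ℕ → Idx q₁ q₂ → ℝ} {e : ℕ → ℝ} {n : ℕ} {θ θ₀ : Idx q₁ q₂ → ℝ}
  {S : Finset (Fin q₂)}

/-- The residual is `e_t - u_tᵀ (θ - θ₀)`. Only the direction `h` has to lie in the sub-model, not
`θ₀`, so a misspecified sub-model is covered. -/
lemma IsMLE.dotProduct_gram_mulVec_sub (hv : 0 < v) (hθ : IsMLE v u (response u θ₀ e) n S θ)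
    {h : Idx q₁ q₂ → ℝ} (hh : h ∈ subModel (q₁ := q₁) S) :
    h ⬝ᵥ (gram u n *ᵥ (θ - θ₀)) = h ⬝ᵥ errorSum u e n := by
  have := hθ.normal_eq hv hh
  rw [dotProduct_gram_mulVec, dotProduct_errorSum, ← sub_eq_zero, ← neg_eq_zero, ← this,
    ← Finset.sum_sub_distrib, ← Finset.sum_neg_distrib]
  refine Finset.sum_congr rfl fun t _ => ?_
  rw [response, dotProduct_sub]
  ring

lemma IsMLE.gram_mulVec_sub (hv : 0 < v) (hθ : IsMLE v u (response u θ₀ e) n Finset.univ θ) :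
    gram u n *ᵥ (θ - θ₀) = errorSum u e n := by
  rw [← sub_eq_zero]
  refine dotProduct_eq_zero _ fun h => ?_
  rw [dotProduct_comm, dotProduct_sub,
    hθ.dotProduct_gram_mulVec_sub hv (fun j hj => absurd (Finset.mem_univ j) hj), sub_self]

lemma IsMLE.sub_eq (hv : 0 < v) (hθ : IsMLE v u (response u θ₀ e) n Finset.univ θ)
    (hG : (gram u n).PosDef) : θ - θ₀ = (gram u n)⁻¹ *ᵥ errorSum u e n := by
  rw [← hθ.gram_mulVec_sub hv, mulVec_mulVec,
    nonsing_inv_mul _ ((isUnit_iff_isUnit_det _).1 hG.isUnit), one_mulVec]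

lemma IsMLE.sum_residual_sq (hv : 0 < v) (hθ : IsMLE v u (response u θ₀ e) n Finset.univ θ)
    (hG : (gram u n).PosDef) :
    ∑ t ∈ Finset.range n, (response u θ₀ e t - u t ⬝ᵥ θ) ^ 2
      = ∑ t ∈ Finset.range n, e t ^ 2
        - errorSum u e n ⬝ᵥ ((gram u n)⁻¹ *ᵥ errorSum u e n) := by
  have h1 : ∑ t ∈ Finset.range n, (response u θ₀ e t - u t ⬝ᵥ θ) ^ 2
      = ∑ t ∈ Finset.range n, e t ^ 2 - 2 * ((θ - θ₀) ⬝ᵥ errorSum u e n)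
        + (θ - θ₀) ⬝ᵥ (gram u n *ᵥ (θ - θ₀)) := by
    rw [dotProduct_errorSum, dotProduct_gram_mulVec, Finset.mul_sum, ← Finset.sum_sub_distrib,
      ← Finset.sum_add_distrib]
    refine Finset.sum_congr rfl fun t _ => ?_
    rw [response, dotProduct_sub]
    ring
  rw [h1, hθ.gram_mulVec_sub hv, ← hθ.sub_eq hv hG, dotProduct_comm (errorSum u e n)]
  ring

lemma sampleInfo_posDef (hv : 0 < v) (hn : 0 < n) (hG : (gram u n).PosDef) :
    (sampleInfo v u n).PosDef := by
  have hv' : (0 : ℝ) < v := hv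
  exact hG.smul (by positivity)

lemma dotProduct_inv_mulVec_pos {A : Matrix (Idx q₁ q₂) (Idx q₁ q₂) ℝ} (hA : A.PosDef)
    {l : Idx q₁ q₂ → ℝ} (hl : l ≠ 0) : 0 < l ⬝ᵥ (A⁻¹ *ᵥ l) := by
  simpa using hA.inv.dotProduct_mulVec_pos hl

lemma scalePhi_sampleInfo (hv : 0 < v) (hn : 0 < n) (hG : (gram u n).PosDef)
    (a : Fin q₁ → ℝ) (b : Fin q₂ → ℝ) :
    scalePhi (sampleInfo v u n) a b = √n * √v *
      √(Sum.elim a b ⬝ᵥ ((gram u n)⁻¹ *ᵥ Sum.elim a b)) := by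
  have hv' : (0 : ℝ) < v := hv
  have hk : ((n : ℝ) * v)⁻¹ ≠ 0 := by positivity
  have := invertibleOfNonzero hk
  rw [scalePhi_eq (sampleInfo_posDef hv hn hG), sampleInfo_eq,
    inv_smul _ _ ((isUnit_iff_isUnit_det _).1 hG.isUnit), invOf_eq_inv, inv_inv, smul_mulVec,
    dotProduct_smul, smul_eq_mul, Real.sqrt_mul (by positivity), Real.sqrt_mul (by positivity)]

variable {M : ℕ}

/-- The bias correction removes the effect of the restrictions exactly. -/
lemma avgFocus_sub_biasCorr {σ2 s : ℝ≥0} (hσ : 0 < σ2) (hs : 0 < s) (hn : 0 < n)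
    (hG : (gram u n).PosDef) (a : Fin q₁ → ℝ) (b : Fin q₂ → ℝ) (S : Fin M → Finset (Fin q₂))
    {w : Fin M → ℝ} (hw : ∑ m, w m = 1) {est : Finset (Fin q₂) → Idx q₁ q₂ → ℝ}
    (hest : ∀ A, IsMLE σ2 u (response u θ₀ e) n A (est A)) :
    √n * (avgFocus a b S w est - focus a b θ₀) - biasCorr (sampleInfo s u n) a b S w n est
      = √n * (focus a b (est Finset.univ) - focus a b θ₀) := by
  have hJ := sampleInfo_posDef hs hn hG
  set J := sampleInfo s u n with hJdef
  set γ := est Finset.univ ∘ Sum.inr with hγ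
  have hm : ∀ m, focus a b (est (S m)) = focus a b (est Finset.univ) +
      vecOmega J a b ⬝ᵥ (γ - shrinkMat (matK J) (S m) *ᵥ γ) := by
    intro m
    refine focus_restricted hJ a b (S m) (hest _).1 fun h hh => ?_
    -- Along `h` the restricted and the full normal equations have the same right-hand side, so
    -- their difference is the required orthogonality. The factor `(n s)⁻¹` in the sample
    -- information plays no role.
    have h1 := (hest (S m)).dotProduct_gram_mulVec_sub hσ hh
    have h2 := (hest Finset.univ).gram_mulVec_sub hσ
    rw [← h2] at h1
    rw [hJdef, sampleInfo_eq, smul_mulVec, dotProduct_smul,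
      ← sub_sub_sub_cancel_right (est (S m)) _ θ₀, mulVec_sub, dotProduct_sub, h1, sub_self,
      smul_zero]
  have havg : avgFocus a b S w est = focus a b (est Finset.univ) +
      vecOmega J a b ⬝ᵥ (γ - (∑ m, w m • shrinkMat (matK J) (S m)) *ᵥ γ) := by
    simp only [avgFocus, hm, mul_add, Finset.sum_add_distrib, dotProduct_sub, mul_sub,
      Finset.sum_sub_distrib, ← Finset.sum_mul, hw, one_mul, sum_mulVec, smul_mulVec,
      dotProduct_sum, dotProduct_smul, smul_eq_mul]
  have hbias : biasCorr J a b S w n est = √n *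
      (vecOmega J a b ⬝ᵥ (γ - (∑ m, w m • shrinkMat (matK J) (S m)) *ᵥ γ)) := by
    rw [biasCorr, deltaHat_matK hJ.posSemidef, vecD, mulVec_smul, ← smul_sub, dotProduct_smul,
      smul_eq_mul]
  rw [havg, hbias]
  ring

/-- The sum of squares of the unnormalised coefficients is `lᵀ G⁻¹ G G⁻¹ l = lᵀ G⁻¹ l`, the square
of the normalising constant. -/
lemma sum_errorCoef_sq (hG : (gram u n).PosDef) {l : Idx q₁ q₂ → ℝ} (hl : l ≠ 0) :
    ∑ t ∈ Finset.range n, errorCoef l u n t ^ 2 = 1 := by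
  have hpos := dotProduct_inv_mulVec_pos hG hl
  have hGi : (gram u n)⁻¹ᵀ = (gram u n)⁻¹ := by
    have := hG.inv.1
    rwa [IsHermitian, conjTranspose_eq_transpose_of_trivial] at this
  have hsym : ∀ t, l ⬝ᵥ ((gram u n)⁻¹ *ᵥ u t) = u t ⬝ᵥ ((gram u n)⁻¹ *ᵥ l) := fun t => by
    rw [dotProduct_mulVec, ← mulVec_transpose, hGi, dotProduct_comm]
  simp only [errorCoef, div_pow, Real.sq_sqrt hpos.le, ← Finset.sum_div, hsym]
  rw [div_eq_one_iff_eq hpos.ne']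
  simp only [sq]
  rw [← dotProduct_gram_mulVec, mulVec_mulVec,
    mul_nonsing_inv _ ((isUnit_iff_isUnit_det _).1 hG.isUnit), one_mulVec, dotProduct_comm]

/-- The factor `√n` cancels against the one in `φ̂`, and the variance estimate `s` survives only as
the divisor `√s`. -/
lemma tStat_eq {σ2 s : ℝ≥0} (hσ : 0 < σ2) (hs : 0 < s) (hn : 0 < n)
    (hG : (gram u n).PosDef) (a : Fin q₁ → ℝ) (b : Fin q₂ → ℝ) (S : Fin M → Finset (Fin q₂))
    {w : Fin M → ℝ} (hw : ∑ m, w m = 1) {est : Finset (Fin q₂) → Idx q₁ q₂ → ℝ}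
    (hest : ∀ A, IsMLE σ2 u (response u θ₀ e) n A (est A)) :
    tStat (sampleInfo s u n) a b S w n est θ₀
      = (∑ t ∈ Finset.range n, errorCoef (Sum.elim a b) u n t * e t) / √s := by
  have hn' : √(n : ℝ) ≠ 0 := by positivity
  have h1 : focus a b (est Finset.univ) - focus a b θ₀
      = ∑ t ∈ Finset.range n, (Sum.elim a b ⬝ᵥ ((gram u n)⁻¹ *ᵥ u t)) * e t := by
    rw [focus_eq_dotProduct, focus_eq_dotProduct, ← dotProduct_sub,
      (hest Finset.univ).sub_eq hσ hG, errorSum, mulVec_sum, dotProduct_sum]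
    refine Finset.sum_congr rfl fun t _ => ?_
    rw [mulVec_smul, dotProduct_smul, smul_eq_mul, mul_comm]
  rw [tStat, avgFocus_sub_biasCorr hσ hs hn hG a b S hw hest, scalePhi_sampleInfo hs hn hG, h1,
    mul_assoc, mul_div_mul_left _ _ hn', ← div_div, div_right_comm, Finset.sum_div]
  congr 1
  refine Finset.sum_congr rfl fun t _ => ?_
  rw [errorCoef, div_mul_eq_mul_div]

lemma mem_confInt_iff {J : Matrix (Idx q₁ q₂) (Idx q₁ q₂) ℝ} {a : Fin q₁ → ℝ} {b : Fin q₂ → ℝ}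
    (hφ : 0 < scalePhi J a b) (hn : 0 < n) (S : Fin M → Finset (Fin q₂)) (w : Fin M → ℝ)
    (est : Finset (Fin q₂) → Idx q₁ q₂ → ℝ) (α : ℝ) :
    focus a b θ₀ ∈ confInt J a b S w n est α ↔ tStat J a b S w n est θ₀ ∈
      Set.Icc (-normalQuantile (1 - α / 2)) (normalQuantile (1 - α / 2)) := by
  have hn' : 0 < √(n : ℝ) := by positivity
  -- The upper end of the interval bounds the statistic from below, and the lower end from above;
  -- hence the swap.
  rw [confInt, tStat, Set.mem_Icc, Set.mem_Icc, le_div_iff₀ hφ, div_le_iff₀ hφ, and_comm]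
  set z := normalQuantile (1 - α / 2)
  set m := avgFocus a b S w est
  set B := biasCorr J a b S w n est
  refine and_congr ?_ ?_
  · have : m - B / √n + z * scalePhi J a b / √n - focus a b θ₀
        = (√n * (m - focus a b θ₀) - B + z * scalePhi J a b) / √n := by field_simp; ring
    rw [← sub_nonneg, this, le_div_iff₀ hn', zero_mul]
    constructor <;> intro h <;> linarith
  · have : focus a b θ₀ - (m - B / √n - z * scalePhi J a b / √n)
        = (z * scalePhi J a b - (√n * (m - focus a b θ₀) - B)) / √n := by field_simp; ring
    rw [← sub_nonneg, this, le_div_iff₀ hn', zero_mul]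
    constructor <;> intro h <;> linarith

end LeastSquares

/-! ### Measurability of the estimators, weights and statistic -/

section Measurability

variable {Ω : Type*} [MeasurableSpace Ω] {l m n : Type*}

lemma measurable_mul_entry [Fintype m] {A : Ω → Matrix l m ℝ} {B : Ω → Matrix m n ℝ}
    (hA : ∀ i j, Measurable fun ω => A ω i j) (hB : ∀ i j, Measurable fun ω => B ω i j)
    (i : l) (j : n) : Measurable fun ω => (A ω * B ω) i j := by
  simp only [mul_apply]
  exact Finset.measurable_sum _ fun k _ => (hA i k).mul (hB k j)

lemma measurable_mulVec_entry [Fintype m] {A : Ω → Matrix l m ℝ} {v : Ω → m → ℝ}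
    (hA : ∀ i j, Measurable fun ω => A ω i j) (hv : ∀ j, Measurable fun ω => v ω j)
    (i : l) : Measurable fun ω => (A ω *ᵥ v ω) i :=
  Finset.measurable_sum _ fun k _ => (hA i k).mul (hv k)

lemma measurable_dotProduct [Fintype m] {v w : Ω → m → ℝ} (hv : ∀ j, Measurable fun ω => v ω j)
    (hw : ∀ j, Measurable fun ω => w ω j) : Measurable fun ω => v ω ⬝ᵥ w ω :=
  Finset.measurable_sum _ fun k _ => (hv k).mul (hw k)

variable [Fintype n] [DecidableEq n]

lemma measurable_det {A : Ω → Matrix n n ℝ} (hA : ∀ i j, Measurable fun ω => A ω i j) :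
    Measurable fun ω => (A ω).det := by
  simp only [det_apply]
  exact Finset.measurable_sum _ fun τ _ =>
    (Finset.measurable_prod _ fun i _ => hA (τ i) i).const_smul _

/-- The formula by adjugate and determinant holds for singular matrices as well, with the
conventional value `0⁻¹ = 0`. -/
lemma measurable_inv_entry {A : Ω → Matrix n n ℝ} (hA : ∀ i j, Measurable fun ω => A ω i j)
    (i j : n) : Measurable fun ω => (A ω)⁻¹ i j := by
  simp only [inv_def, Ring.inverse_eq_inv', Matrix.smul_apply, smul_eq_mul, adjugate_apply]
  refine (measurable_det hA).inv.mul (measurable_det fun k k' => ?_)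
  by_cases h : k = j
  · simp [updateRow_apply, h]
  · simpa [updateRow_apply, h] using hA k k'

variable {q₁ q₂ M : ℕ}

lemma measurable_gram_entry {u : Ω → ℕ → Idx q₁ q₂ → ℝ} (hu : ∀ t, Measurable fun ω => u ω t)
    (k : ℕ) (i j : Idx q₁ q₂) : Measurable fun ω => gram (u ω) k i j := by
  simp only [gram, Matrix.sum_apply, vecMulVec_apply]
  exact Finset.measurable_sum _ fun t _ => ((hu t).eval).mul ((hu t).eval)

lemma measurable_sampleInfo_entry {u : Ω → ℕ → Idx q₁ q₂ → ℝ} {s : Ω → ℝ≥0} (hs : Measurable s)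
    (hu : ∀ t, Measurable fun ω => u ω t) (k : ℕ) (i j : Idx q₁ q₂) :
    Measurable fun ω => sampleInfo (s ω) (u ω) k i j := by
  simp only [sampleInfo_eq, Matrix.smul_apply, smul_eq_mul]
  exact (measurable_const.mul hs.coe_nnreal_real).inv.mul (measurable_gram_entry hu k i j)

lemma measurable_toBlocks₁₁_inv_entry {J : Ω → Matrix (Idx q₁ q₂) (Idx q₁ q₂) ℝ}
    (hJ : ∀ i j, Measurable fun ω => J ω i j) (i j : Fin q₁) :
    Measurable fun ω => (J ω).toBlocks₁₁⁻¹ i j :=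
  measurable_inv_entry (A := fun ω => (J ω).toBlocks₁₁) (fun _ _ => hJ _ _) i j

lemma measurable_toBlocks₂₁_mul_inv_entry {J : Ω → Matrix (Idx q₁ q₂) (Idx q₁ q₂) ℝ}
    (hJ : ∀ i j, Measurable fun ω => J ω i j) (i : Fin q₂) (j : Fin q₁) :
    Measurable fun ω => ((J ω).toBlocks₂₁ * (J ω).toBlocks₁₁⁻¹) i j :=
  measurable_mul_entry (A := fun ω => (J ω).toBlocks₂₁) (fun _ _ => hJ _ _)
    (measurable_toBlocks₁₁_inv_entry hJ) i j

lemma measurable_matK_entry {J : Ω → Matrix (Idx q₁ q₂) (Idx q₁ q₂) ℝ}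
    (hJ : ∀ i j, Measurable fun ω => J ω i j) (i j : Fin q₂) :
    Measurable fun ω => matK (J ω) i j :=
  measurable_inv_entry (A := fun ω => schur (J ω)) (fun i j => (hJ _ _).sub <|
    measurable_mul_entry (B := fun ω => (J ω).toBlocks₁₂)
      (measurable_toBlocks₂₁_mul_inv_entry hJ) (fun _ _ => hJ _ _) i j) i j

lemma measurable_vecOmega_entry {J : Ω → Matrix (Idx q₁ q₂) (Idx q₁ q₂) ℝ}
    (hJ : ∀ i j, Measurable fun ω => J ω i j) (a : Fin q₁ → ℝ) (b : Fin q₂ → ℝ) (j : Fin q₂) :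
    Measurable fun ω => vecOmega (J ω) a b j :=
  (measurable_mulVec_entry (v := fun _ => a) (measurable_toBlocks₂₁_mul_inv_entry hJ)
    (fun _ => measurable_const) j).sub measurable_const

lemma measurable_scalePhi {J : Ω → Matrix (Idx q₁ q₂) (Idx q₁ q₂) ℝ}
    (hJ : ∀ i j, Measurable fun ω => J ω i j) (a : Fin q₁ → ℝ) (b : Fin q₂ → ℝ) :
    Measurable fun ω => scalePhi (J ω) a b :=
  ((measurable_dotProduct (v := fun _ => a) (fun _ => measurable_const)
    (measurable_mulVec_entry (v := fun _ => a) (measurable_toBlocks₁₁_inv_entry hJ)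
      fun _ => measurable_const)).add
    (measurable_dotProduct (measurable_vecOmega_entry hJ a b) (measurable_mulVec_entry
      (measurable_matK_entry hJ) (measurable_vecOmega_entry hJ a b)))).sqrt

lemma measurable_shrinkMat_entry {K : Ω → Matrix (Fin q₂) (Fin q₂) ℝ}
    (hK : ∀ i j, Measurable fun ω => K ω i j) (S : Finset (Fin q₂)) (i j : Fin q₂) :
    Measurable fun ω => shrinkMat (K ω) S i j := by
  have hKi := measurable_inv_entry hK
  have hc : ∀ {l m : Type} (B : Matrix l m ℝ) (i : l) (j : m), Measurable fun _ : Ω => B i j :=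
    fun _ _ _ => measurable_const
  exact measurable_mul_entry (measurable_mul_entry (measurable_mul_entry (hc _)
    (measurable_inv_entry (measurable_mul_entry (measurable_mul_entry (hc _) hKi) (hc _))))
    (hc _)) hKi i j

lemma measurable_focus {θ : Ω → Idx q₁ q₂ → ℝ} (hθ : Measurable θ) (a : Fin q₁ → ℝ)
    (b : Fin q₂ → ℝ) : Measurable fun ω => focus a b (θ ω) := by
  simp only [focus_eq_dotProduct]
  exact measurable_dotProduct (fun _ => measurable_const) fun j => hθ.eval

lemma measurable_tStat {u : Ω → ℕ → Idx q₁ q₂ → ℝ} {s : Ω → ℝ≥0} (hs : Measurable s)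
    (hu : ∀ t, Measurable fun ω => u ω t) {w : Ω → Fin M → ℝ} (hw : Measurable w)
    {est : Ω → Finset (Fin q₂) → Idx q₁ q₂ → ℝ} (hest : ∀ A, Measurable fun ω => est ω A)
    (a : Fin q₁ → ℝ) (b : Fin q₂ → ℝ) (S : Fin M → Finset (Fin q₂)) (k : ℕ)
    (θ₀ : Idx q₁ q₂ → ℝ) :
    Measurable fun ω => tStat (sampleInfo (s ω) (u ω) k) a b S (w ω) k (est ω) θ₀ := by
  have hJ := measurable_sampleInfo_entry hs hu k
  have hD : ∀ j, Measurable fun ω => vecD k (est ω) j := fun j =>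
    measurable_const.mul (hest Finset.univ).eval
  have havg : Measurable fun ω => avgFocus a b S (w ω) (est ω) :=
    Finset.measurable_sum _ fun m _ => hw.eval.mul (measurable_focus (hest _) a b)
  have hbias : Measurable fun ω => biasCorr (sampleInfo (s ω) (u ω) k) a b S (w ω) k (est ω) := by
    simp only [biasCorr, deltaHat_matK (sampleInfo_posSemidef _ _ _)]
    refine measurable_dotProduct (measurable_vecOmega_entry hJ a b) fun j => (hD j).sub ?_
    refine measurable_mulVec_entry (fun i j => ?_) hD j
    simp only [Matrix.sum_apply, Matrix.smul_apply, smul_eq_mul]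
    exact Finset.measurable_sum _ fun m _ =>
      hw.eval.mul (measurable_shrinkMat_entry (measurable_matK_entry hJ) _ i j)
  exact ((measurable_const.mul (havg.sub measurable_const)).sub hbias).div
    (measurable_scalePhi hJ a b)

lemma measurable_logLik {u : Ω → ℕ → Idx q₁ q₂ → ℝ} {y : Ω → ℕ → ℝ} {s : Ω → ℝ≥0}
    {θ : Ω → Idx q₁ q₂ → ℝ} (hs : Measurable s) (hu : ∀ t, Measurable fun ω => u ω t)
    (hy : ∀ t, Measurable fun ω => y ω t) (hθ : Measurable θ) (k : ℕ) :
    Measurable fun ω => logLik (s ω) (u ω) (y ω) k (θ ω) :=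
  Finset.measurable_sum _ fun t _ => Real.measurable_log.comp <|
    measurable_uncurry_gaussianPDFReal.comp
      ((measurable_dotProduct (fun _ => (hu t).eval) fun _ => hθ.eval).prodMk (hs.prodMk (hy t)))

lemma measurable_icWeight {u : Ω → ℕ → Idx q₁ q₂ → ℝ} {y : Ω → ℕ → ℝ} {s : Ω → ℝ≥0}
    (hs : Measurable s) (hu : ∀ t, Measurable fun ω => u ω t)
    (hy : ∀ t, Measurable fun ω => y ω t) {est : Ω → Finset (Fin q₂) → Idx q₁ q₂ → ℝ}
    (hest : ∀ A, Measurable fun ω => est ω A) (c : ℝ) (k : ℕ) (S : Fin M → Finset (Fin q₂)) :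
    Measurable fun ω => icWeight c (s ω) (u ω) (y ω) k (est ω) S := by
  have h : ∀ A, Measurable fun ω => Real.exp (-icScore c (s ω) (u ω) (y ω) k (est ω) A / 2) :=
    fun A => ((((measurable_logLik hs hu hy (hest A) k).const_mul _).add
      measurable_const).neg.div_const _).exp
  exact measurable_pi_lambda _ fun m => (h _).div (Finset.measurable_sum _ fun _ _ => h _)

lemma measurable_residualVar {u : Ω → ℕ → Idx q₁ q₂ → ℝ} {y : Ω → ℕ → ℝ}
    {θ : Ω → Idx q₁ q₂ → ℝ} (hu : ∀ t, Measurable fun ω => u ω t)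
    (hy : ∀ t, Measurable fun ω => y ω t) (hθ : Measurable θ) (k : ℕ) :
    Measurable fun ω => residualVar (u ω) (y ω) k (θ ω) :=
  ((Finset.measurable_sum _ fun t _ => ((hy t).sub (measurable_dotProduct
    (fun _ => (hu t).eval) fun _ => hθ.eval)).pow_const 2).div_const _).real_toNNReal

lemma sum_icWeight (hM : 0 < M) (c : ℝ) (v : ℝ≥0) (u : ℕ → Idx q₁ q₂ → ℝ) (y : ℕ → ℝ) (k : ℕ)
    (est : Finset (Fin q₂) → Idx q₁ q₂ → ℝ) (S : Fin M → Finset (Fin q₂)) :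
    ∑ m, icWeight c v u y k est S m = 1 := by
  have : Nonempty (Fin M) := ⟨⟨0, hM⟩⟩
  simp only [icWeight, ← Finset.sum_div]
  exact div_self (Finset.sum_pos (fun _ _ => Real.exp_pos _) Finset.univ_nonempty).ne'

lemma measurable_errorCoef {α : Type*} [MeasurableSpace α] {u : α → ℕ → Idx q₁ q₂ → ℝ}
    (hu : ∀ t, Measurable fun ω => u ω t) (l : Idx q₁ q₂ → ℝ) (k t : ℕ) :
    Measurable fun ω => errorCoef l (u ω) k t := by
  have hG := measurable_inv_entry (measurable_gram_entry hu k)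
  exact (measurable_dotProduct (v := fun _ => l) (fun _ => measurable_const)
    (measurable_mulVec_entry hG (v := fun ω => u ω t) fun _ => (hu t).eval)).div
    (measurable_dotProduct (v := fun _ => l) (fun _ => measurable_const)
      (measurable_mulVec_entry hG (v := fun _ => l) fun _ => measurable_const)).sqrt

end Measurability

/-! ### Exceptional events of vanishing probability -/

section ConvergenceInMeasure

variable {Ω : Type*} [MeasurableSpace Ω] {P : Measure Ω}

lemma tendsto_measure_eq_of_tendstoInMeasure {E : Type*} [MetricSpace E]
    {f : ℕ → Ω → E} {c d : E} (hcd : d ≠ c) (hf : TendstoInMeasure P f atTop fun _ => c) :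
    Tendsto (fun n => P {ω | f n ω = d}) atTop (𝓝 0) := by
  rw [tendstoInMeasure_iff_dist] at hf
  refine tendsto_of_tendsto_of_tendsto_of_le_of_le tendsto_const_nhds
    (hf (dist d c) (dist_pos.2 hcd)) (fun _ => zero_le) fun n => measure_mono fun ω hω => ?_
  rw [Set.mem_ofPred_eq] at hω ⊢
  rw [hω]

lemma tendstoInMeasure_sub_of_eq {f g : ℕ → Ω → ℝ} {B : ℕ → Set Ω}
    (hB : Tendsto (fun n => P (B n)) atTop (𝓝 0)) (hfg : ∀ n, ∀ ω ∉ B n, f n ω = g n ω) :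
    TendstoInMeasure P (fun n ω => f n ω - g n ω) atTop fun _ => 0 := by
  rw [tendstoInMeasure_iff_norm]
  intro ε hε
  refine tendsto_of_tendsto_of_tendsto_of_le_of_le tendsto_const_nhds hB (fun _ => zero_le)
    fun n => measure_mono fun ω hω => ?_
  by_contra h
  rw [Set.mem_ofPred_eq, hfg n ω h] at hω
  simp at hω
  linarith

end ConvergenceInMeasure

/-! ### Independence, Gaussian mixtures, limit theorems and normal quantiles -/

section Probability

variable {Ω : Type*} [MeasurableSpace Ω] {P : Measure Ω} [IsProbabilityMeasure P]

/-- If the pairs `(X t, e t)` are independent, and in each pair the components are, then the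
tuple of the `X t` is independent of the tuple of the `e t`. -/
lemma indepFun_tuples {ι α β : Type*} [Fintype ι] [MeasurableSpace α] [MeasurableSpace β]
    {X : ι → Ω → α} {e : ι → Ω → β} (hX : ∀ t, Measurable (X t)) (he : ∀ t, Measurable (e t))
    (hpair : iIndepFun (fun t ω => (X t ω, e t ω)) P) (hXe : ∀ t, IndepFun (X t) (e t) P) :
    IndepFun (fun ω t => X t ω) (fun ω t => e t ω) P := by
  have hXi : iIndepFun X P := hpair.comp (fun _ => Prod.fst) fun _ => measurable_fst
  have hei : iIndepFun e P := hpair.comp (fun _ => Prod.snd) fun _ => measurable_snd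
  have hXp : ∀ t, IsProbabilityMeasure (P.map (X t)) :=
    fun t => Measure.isProbabilityMeasure_map (hX t).aemeasurable
  have hep : ∀ t, IsProbabilityMeasure (P.map (e t)) :=
    fun t => Measure.isProbabilityMeasure_map (he t).aemeasurable
  -- The joint law is a product over `t` of products of two marginals; regrouping the factors gives
  -- the law of all `X t` times the law of all `e t`.
  have hjoint : P.map (fun ω t => (X t ω, e t ω))
      = Measure.pi fun t => (P.map (X t)).prod (P.map (e t)) := by
    rw [(iIndepFun_iff_map_fun_eq_pi_map
      fun t => ((hX t).prodMk (he t)).aemeasurable).1 hpair]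
    congr with t : 1
    exact (indepFun_iff_map_prod_eq_prod_map_map (hX t).aemeasurable (he t).aemeasurable).1 (hXe t)
  rw [indepFun_iff_map_prod_eq_prod_map_map (measurable_pi_lambda _ hX).aemeasurable
    (measurable_pi_lambda _ he).aemeasurable,
    (iIndepFun_iff_map_fun_eq_pi_map fun t => (hX t).aemeasurable).1 hXi,
    (iIndepFun_iff_map_fun_eq_pi_map fun t => (he t).aemeasurable).1 hei,
    ← (measurePreserving_arrowProdEquivProdArrow α β ι (fun t => P.map (X t))
      fun t => P.map (e t)).map_eq, ← hjoint,
    Measure.map_map (MeasurableEquiv.measurable _)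
      (measurable_pi_lambda _ fun t => (hX t).prodMk (he t))]
  rfl

/-- A linear combination of independent centred Gaussian variables, with random coefficients that
are independent of these, is a mixture of Gaussian variables. -/
lemma charFun_map_sum_mul {ι α : Type*} [Fintype ι] [MeasurableSpace α] {X : Ω → α}
    {e : ι → Ω → ℝ} {v : ℝ≥0} (hX : Measurable X) (he : ∀ t, Measurable (e t))
    (hei : iIndepFun e P) (hlaw : ∀ t, HasLaw (e t) (gaussianReal 0 v) P)
    (hXe : IndepFun X (fun ω t => e t ω) P) {c : α → ι → ℝ} (hc : Measurable c) (r : ℝ) :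
    charFun (P.map fun ω => ∑ t, c (X ω) t * e t ω) r
      = ∫ ω, Complex.exp (-(v * r ^ 2 * ∑ t, c (X ω) t ^ 2) / 2 : ℝ) ∂P := by
  have hem : Measurable fun ω t => e t ω := measurable_pi_lambda _ he
  have hepi : P.map (fun ω t => e t ω) = Measure.pi fun _ => gaussianReal 0 v := by
    rw [(iIndepFun_iff_map_fun_eq_pi_map fun t => (he t).aemeasurable).1 hei]
    congr with t : 1
    exact (hlaw t).map_eq
  have hXp : IsProbabilityMeasure (P.map X) := Measure.isProbabilityMeasure_map hX.aemeasurable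
  have hg : Measurable fun p : α × (ι → ℝ) => ∑ t, c p.1 t * p.2 t :=
    Finset.measurable_sum _ fun t _ => (hc.comp measurable_fst).eval.mul measurable_snd.eval
  have hjoint : P.map (fun ω => ∑ t, c (X ω) t * e t ω)
      = ((P.map X).prod (Measure.pi fun _ => gaussianReal 0 v)).map
        fun p : α × (ι → ℝ) => ∑ t, c p.1 t * p.2 t := by
    rw [← hepi, ← (indepFun_iff_map_prod_eq_prod_map_map hX.aemeasurable hem.aemeasurable).1 hXe,
      Measure.map_map hg (hX.prodMk hem)]
    rfl
  have hf : Measurable fun x : ℝ => Complex.exp (r * x * Complex.I) := by fun_prop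
  have hF : Measurable fun p : α × (ι → ℝ) =>
      Complex.exp (r * ((∑ t, c p.1 t * p.2 t : ℝ) : ℂ) * Complex.I) := hf.comp hg
  -- By Fubini the errors are integrated out first, with the regressors and hence the coefficients
  -- held fixed.
  rw [hjoint, charFun_apply_real, integral_map hg.aemeasurable hf.aestronglyMeasurable,
    integral_prod, integral_map hX.aemeasurable]
  · refine integral_congr_ae (ae_of_all _ fun ω => ?_)
    have hprod : ∀ y : ι → ℝ, Complex.exp (r * ((∑ t, c (X ω) t * y t : ℝ) : ℂ) * Complex.I)
        = ∏ t, Complex.exp (((r * c (X ω) t : ℝ) : ℂ) * y t * Complex.I) := by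
      intro y
      rw [← Complex.exp_sum]
      congr 1
      push_cast
      rw [Finset.mul_sum, Finset.sum_mul]
      exact Finset.sum_congr rfl fun t _ => by ring
    simp only [hprod]
    rw [integral_fintype_prod_eq_prod
      (f := fun t (x : ℝ) => Complex.exp (((r * c (X ω) t : ℝ) : ℂ) * x * Complex.I))]
    simp only [← charFun_apply_real, charFun_gaussianReal]
    rw [← Complex.exp_sum]
    congr 1
    push_cast
    rw [Finset.mul_sum, ← Finset.sum_neg_distrib, Finset.sum_div]
    exact Finset.sum_congr rfl fun t _ => by ring
  · exact hF.stronglyMeasurable.integral_prod_right'.aestronglyMeasurable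
  · refine Integrable.of_bound (C := 1) hF.aestronglyMeasurable (ae_of_all _ fun p => ?_)
    rw [← Complex.ofReal_mul, Complex.norm_exp_ofReal_mul_I]

lemma tendstoInDistribution_of_charFun {Z : ℕ → Ω → ℝ} (hZ : ∀ n, Measurable (Z n))
    {μ : Measure ℝ} [IsProbabilityMeasure μ]
    (h : ∀ r, Tendsto (fun n => charFun (P.map (Z n)) r) atTop (𝓝 (charFun μ r))) :
    TendstoInDistribution Z atTop id (fun _ => P) μ where
  forall_aemeasurable n := (hZ n).aemeasurable
  tendsto := by
    refine ProbabilityMeasure.tendsto_of_tendsto_charFun fun r => ?_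
    simpa using h r

/-- Strong law of large numbers for functions of independent pairs with common marginal laws. -/
lemma strong_law_pairs {α β : Type*} [MeasurableSpace α] [MeasurableSpace β]
    {X : ℕ → Ω → α} {e : ℕ → Ω → β} (hX : ∀ t, Measurable (X t)) (he : ∀ t, Measurable (e t))
    (hpair : iIndepFun (fun t ω => (X t ω, e t ω)) P) (hXe : ∀ t, IndepFun (X t) (e t) P)
    (hXid : ∀ t, IdentDistrib (X t) (X 0) P P) (heid : ∀ t, IdentDistrib (e t) (e 0) P P)
    {f : α × β → ℝ} (hf : Measurable f) (hint : Integrable (fun ω => f (X 0 ω, e 0 ω)) P) :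
    ∀ᵐ ω ∂P, Tendsto (fun n : ℕ => (∑ t ∈ Finset.range n, f (X t ω, e t ω)) / n) atTop
      (𝓝 (∫ ω, f (X 0 ω, e 0 ω) ∂P)) := by
  refine strong_law_ae_real (fun t ω => f (X t ω, e t ω)) hint (fun s t hst => ?_) fun t => ?_
  · exact (hpair.indepFun hst).comp hf hf
  · refine IdentDistrib.comp (u := f) ⟨((hX t).prodMk (he t)).aemeasurable,
      ((hX 0).prodMk (he 0)).aemeasurable, ?_⟩ hf
    -- Independence within each pair makes its law the product of the marginals, so equal marginal
    -- laws give equal joint laws.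
    rw [(indepFun_iff_map_prod_eq_prod_map_map (hX t).aemeasurable (he t).aemeasurable).1 (hXe t),
      (indepFun_iff_map_prod_eq_prod_map_map (hX 0).aemeasurable (he 0).aemeasurable).1 (hXe 0),
      (hXid t).map_eq, (heid t).map_eq]

/-- Every subsequence has a further subsequence converging almost everywhere, along which continuity
at the single point `c` suffices. -/
lemma tendstoInMeasure_comp_continuousAt {E F : Type*} [PseudoMetricSpace E] [PseudoMetricSpace F]
    {f : ℕ → Ω → E} {c : E} (hf : TendstoInMeasure P f atTop fun _ => c)
    {g : E → F} (hg : ContinuousAt g c) (hgf : ∀ n, AEStronglyMeasurable (fun ω => g (f n ω)) P) :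
    TendstoInMeasure P (fun n ω => g (f n ω)) atTop fun _ => g c := by
  rw [exists_seq_tendstoInMeasure_atTop_iff hgf]
  intro ns hns
  obtain ⟨ns', hns', h⟩ := (hf.comp hns.tendsto_atTop).exists_seq_tendsto_ae
  exact ⟨ns', hns', h.mono fun ω hω => hg.tendsto.comp hω⟩

lemma tendsto_measureReal_of_iff {A A' B : ℕ → Set Ω} {p : ℝ}
    (hB : Tendsto (fun n => P (B n)) atTop (𝓝 0)) (hA : ∀ n, ∀ ω ∉ B n, ω ∈ A n ↔ ω ∈ A' n)
    (h : Tendsto (fun n => P.real (A n)) atTop (𝓝 p)) :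
    Tendsto (fun n => P.real (A' n)) atTop (𝓝 p) := by
  have hB' : Tendsto (fun n => P.real (B n)) atTop (𝓝 0) :=
    (ENNReal.tendsto_toReal ENNReal.zero_ne_top).comp hB
  have hle : ∀ (C C' : ℕ → Set Ω), (∀ n, ∀ ω ∉ B n, ω ∈ C n → ω ∈ C' n) →
      ∀ n, P.real (C n) ≤ P.real (C' n) + P.real (B n) := fun C C' hC n =>
    (measureReal_mono fun ω hω => by
      by_cases hb : ω ∈ B n
      · exact Or.inr hb
      · exact Or.inl (hC n ω hb hω)).trans (measureReal_union_le _ _)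
  refine tendsto_of_tendsto_of_tendsto_of_le_of_le (g := fun n => P.real (A n) - P.real (B n))
    (h := fun n => P.real (A n) + P.real (B n)) (by simpa using h.sub hB')
    (by simpa using h.add hB') (fun n => ?_) fun n => ?_
  · have := hle A A' (fun n ω hb => (hA n ω hb).1) n
    simp only
    linarith
  · exact hle A' A (fun n ω hb => (hA n ω hb).2) n

/-- The standard normal probability of the interval between two symmetric quantiles. -/
lemma gaussianReal_Icc_normalQuantile {α : ℝ} (h0 : 0 < α) (h1 : α < 1) :
    (gaussianReal 0 1).real
      (Set.Icc (-normalQuantile (1 - α / 2)) (normalQuantile (1 - α / 2))) = 1 - α := by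
  set μ := gaussianReal 0 1
  have hna : NullSingletonClass μ := nullSingletonClass_gaussianReal one_ne_zero
  set p := 1 - α / 2 with hp
  have hcont : Continuous (cdf μ) := by
    refine continuous_iff_continuousAt.2 fun x => ?_
    rw [(monotone_cdf μ).continuousAt_iff_leftLim_eq_rightLim, StieltjesFunction.rightLim_eq]
    have hx : (cdf μ).measure {x} = 0 := by rw [measure_cdf, measure_singleton]
    rw [StieltjesFunction.measure_singleton, ENNReal.ofReal_eq_zero] at hx
    exact le_antisymm ((monotone_cdf μ).leftLim_le le_rfl) (by linarith)
  have hneg : ∀ x, cdf μ (-x) = 1 - cdf μ x := by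
    intro x
    have hmap : μ.map (fun y => -y) = μ := by
      have := gaussianReal_map_neg (μ := 0) (v := 1)
      rwa [neg_zero] at this
    have hset : (fun y : ℝ => -y) ⁻¹' Set.Iic (-x) = (Set.Iio x)ᶜ := by
      ext y
      simp
    rw [cdf_eq_real, cdf_eq_real]
    conv_lhs => rw [← hmap]
    rw [map_measureReal_apply measurable_neg measurableSet_Iic, hset,
      probReal_compl_eq_one_sub measurableSet_Iio, measureReal_congr Iio_ae_eq_Iic]
  obtain ⟨z', hz'⟩ : ∃ z', cdf μ z' = p := by
    have hlt : ∃ x, cdf μ x ≤ p :=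
      (((tendsto_cdf_atBot μ).eventually_lt_const (by linarith : (0 : ℝ) < p)).mono
        fun _ h => h.le).exists
    have hgt : ∃ x, p ≤ cdf μ x :=
      (((tendsto_cdf_atTop μ).eventually_const_lt (by linarith : p < (1 : ℝ))).mono
        fun _ h => h.le).exists
    exact mem_range_of_exists_le_of_exists_ge hcont hlt hgt
  obtain ⟨x₀, hx₀⟩ : ∃ x, cdf μ x < p :=
    ((tendsto_cdf_atBot μ).eventually_lt_const (by linarith : (0 : ℝ) < p)).exists
  have hbdd : BddBelow {x | p ≤ cdf μ x} :=
    ⟨x₀, fun x hx => le_of_not_gt fun h => (hx₀.trans_le hx).not_ge (monotone_cdf μ h.le)⟩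
  set z := normalQuantile p with hz
  have hzp : cdf μ z = p := by
    refine le_antisymm ?_ ?_
    · rw [← hz']
      exact monotone_cdf μ (csInf_le hbdd hz'.ge)
    · exact (isClosed_le continuous_const hcont).csInf_mem ⟨z', hz'.ge⟩ hbdd
  -- By symmetry the distribution function is `1/2` at `0`, whereas `p > 1/2` because `α < 1`.
  have hz0 : 0 < z := by
    have h2 := hneg 0
    rw [neg_zero] at h2
    by_contra h
    have := monotone_cdf μ (not_lt.1 h)
    linarith
  have hset : Set.Icc (-z) z = Set.Iic z \ Set.Iio (-z) := by
    ext x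
    simp [and_comm]
  have hsub : Set.Iio (-z) ⊆ Set.Iic z := fun x hx => by
    rw [Set.mem_Iio] at hx
    rw [Set.mem_Iic]
    linarith
  rw [hset, measureReal_sdiff hsub measurableSet_Iio,
    measureReal_congr (Iio_ae_eq_Iic (a := -z)), ← cdf_eq_real, ← cdf_eq_real, hneg, hzp]
  ring

end Probability

/-! ### Consistency of the residual variance and the Gaussian limit -/

section Asymptotics

variable {q₁ q₂ : ℕ}

lemma gram_congr {u u' : ℕ → Idx q₁ q₂ → ℝ} {n : ℕ} (h : ∀ t < n, u t = u' t) :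
    gram u n = gram u' n :=
  Finset.sum_congr rfl fun t ht => by rw [h t (Finset.mem_range.1 ht)]

lemma errorCoef_congr {u u' : ℕ → Idx q₁ q₂ → ℝ} {n : ℕ} (h : ∀ t < n, u t = u' t)
    (l : Idx q₁ q₂ → ℝ) {t : ℕ} (ht : t < n) : errorCoef l u n t = errorCoef l u' n t := by
  rw [errorCoef, errorCoef, gram_congr h, h t ht]

/-- A Gram matrix is always positive semidefinite, so positive definiteness only requires a nonzero
determinant, which is an open condition. -/
lemma eventually_gram_posDef {u : ℕ → Idx q₁ q₂ → ℝ} {A : Matrix (Idx q₁ q₂) (Idx q₁ q₂) ℝ}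
    (hA : A.PosDef) (h : Tendsto (fun n : ℕ => (n : ℝ)⁻¹ • gram u n) atTop (𝓝 A)) :
    ∀ᶠ n in atTop, (gram u n).PosDef := by
  have hdet : Tendsto (fun n : ℕ => ((n : ℝ)⁻¹ • gram u n).det) atTop (𝓝 A.det) :=
    (continuous_id.matrix_det.tendsto A).comp h
  filter_upwards [hdet.eventually_ne (hA.posSemidef.posDef_iff_det_ne_zero.1 hA)] with n hn
  refine (gram_posSemidef u n).posDef_iff_det_ne_zero.2 fun h0 => hn ?_
  rw [det_smul, h0, mul_zero]

/-- With `g = ∑ e_t u_t`, the residual variance is the mean of the `e_t²` minus `(g/n)ᵀ (G/n)⁻¹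
(g/n)`, and this quadratic form tends to zero. -/
lemma tendsto_residualVar {u : ℕ → Idx q₁ q₂ → ℝ} {e : ℕ → ℝ} {θ₀ : Idx q₁ q₂ → ℝ} {v : ℝ≥0}
    (hv : 0 < v) {A : Matrix (Idx q₁ q₂) (Idx q₁ q₂) ℝ} (hA : A.PosDef)
    (hG : Tendsto (fun n : ℕ => (n : ℝ)⁻¹ • gram u n) atTop (𝓝 A))
    (hg : Tendsto (fun n : ℕ => (n : ℝ)⁻¹ • errorSum u e n) atTop (𝓝 0))
    (he : Tendsto (fun n : ℕ => (∑ t ∈ Finset.range n, e t ^ 2) / n) atTop (𝓝 v))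
    {θ : ℕ → Idx q₁ q₂ → ℝ} (hθ : ∀ n, IsMLE v u (response u θ₀ e) n Finset.univ (θ n)) :
    Tendsto (fun n => residualVar u (response u θ₀ e) n (θ n)) atTop (𝓝 v) := by
  have hdetA : A.det ≠ 0 := hA.posSemidef.posDef_iff_det_ne_zero.1 hA
  have hinv : Tendsto (fun n : ℕ => ((n : ℝ)⁻¹ • gram u n)⁻¹) atTop (𝓝 A⁻¹) := by
    simp only [inv_def, Ring.inverse_eq_inv']
    exact (((continuous_id.matrix_det.tendsto A).comp hG).inv₀ hdetA).smul
      ((continuous_id.matrix_adjugate.tendsto A).comp hG)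
  have hq : Tendsto (fun n : ℕ => ((n : ℝ)⁻¹ • errorSum u e n) ⬝ᵥ
      (((n : ℝ)⁻¹ • gram u n)⁻¹ *ᵥ ((n : ℝ)⁻¹ • errorSum u e n))) atTop (𝓝 0) := by
    have hc : Continuous fun p : (Idx q₁ q₂ → ℝ) × Matrix (Idx q₁ q₂) (Idx q₁ q₂) ℝ =>
        p.1 ⬝ᵥ (p.2 *ᵥ p.1) :=
      continuous_fst.dotProduct (continuous_snd.matrix_mulVec continuous_fst)
    have := (hc.tendsto (0, A⁻¹)).comp (hg.prodMk_nhds hinv)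
    rw [zero_dotProduct] at this
    exact this
  have hlim : Tendsto (fun n : ℕ => (∑ t ∈ Finset.range n,
      (response u θ₀ e t - u t ⬝ᵥ θ n) ^ 2) / n) atTop (𝓝 v) := by
    have := he.sub hq
    rw [sub_zero] at this
    refine this.congr' ?_
    filter_upwards [eventually_gram_posDef hA hG, eventually_gt_atTop 0] with n hn h0
    have hk : ((n : ℝ))⁻¹ ≠ 0 := by positivity
    have := invertibleOfNonzero hk
    rw [(hθ n).sum_residual_sq hv hn, inv_smul _ _ ((isUnit_iff_isUnit_det _).1 hn.isUnit),
      invOf_eq_inv, mulVec_smul, smul_mulVec, smul_dotProduct, dotProduct_smul, dotProduct_smul,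
      smul_eq_mul, smul_eq_mul, smul_eq_mul, mul_inv_cancel_left₀ hk]
    ring
  have := (continuous_real_toNNReal.tendsto (v : ℝ)).comp hlim
  rwa [Real.toNNReal_coe] at this

variable {Ω : Type*} [MeasurableSpace Ω] {P : Measure Ω} [IsProbabilityMeasure P]

/-- The standardised error of the full least squares estimate is asymptotically normal. -/
lemma tendstoInDistribution_errorCoef {u : Ω → ℕ → Idx q₁ q₂ → ℝ} {e : ℕ → Ω → ℝ} {v : ℝ≥0}
    (hv : 0 < v) (hu : ∀ t, Measurable fun ω => u ω t) (he : ∀ t, Measurable (e t))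
    (hpair : iIndepFun (fun t ω => (u ω t, e t ω)) P)
    (hexog : ∀ t, IndepFun (fun ω => u ω t) (e t) P)
    (hgauss : ∀ t, HasLaw (e t) (gaussianReal 0 v) P)
    (hG : ∀ᵐ ω ∂P, ∀ᶠ n in atTop, (gram (u ω) n).PosDef)
    {l : Idx q₁ q₂ → ℝ} (hl : l ≠ 0) :
    TendstoInDistribution
      (fun (n : ℕ) ω => ∑ t ∈ Finset.range n, errorCoef l (u ω) n t / √v * e t ω)
      atTop id (fun _ => P) (gaussianReal 0 1) := by
  have hv' : (0 : ℝ) < v := hv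
  have hcm : ∀ n t, Measurable fun ω => errorCoef l (u ω) n t / √v := fun n t =>
    (measurable_errorCoef hu l n t).div_const _
  refine tendstoInDistribution_of_charFun (fun n => Finset.measurable_sum _ fun t _ =>
    (hcm n t).mul (he t)) fun r => ?_
  have hchar : ∀ n : ℕ, charFun (P.map fun ω =>
      ∑ t ∈ Finset.range n, errorCoef l (u ω) n t / √v * e t ω) r = ∫ ω, Complex.exp
        (-(v * r ^ 2 * ∑ t ∈ Finset.range n, (errorCoef l (u ω) n t / √v) ^ 2) / 2 : ℝ) ∂P := by
    intro n
    have hinj := Fin.val_injective (n := n)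
    -- The coefficients at sample size `n` depend on the first `n` regressors only. Padding with
    -- zeros makes them functions of a finite tuple, so that independence of finite tuples suffices.
    let extend : (Fin n → Idx q₁ q₂ → ℝ) → ℕ → Idx q₁ q₂ → ℝ :=
      fun p t => if h : t < n then p ⟨t, h⟩ else 0
    have hext : ∀ t, Measurable fun p => extend p t := by
      intro t
      by_cases h : t < n
      · simpa [extend, h] using measurable_pi_apply (⟨t, h⟩ : Fin n)
      · simp [extend, h]
    have hcoef : ∀ ω (t : Fin n), errorCoef l (extend fun i => u ω i) n t
        = errorCoef l (u ω) n t := fun ω t =>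
      errorCoef_congr (fun t ht => by simp [extend, ht]) l t.2
    have hpair' := hpair.precomp hinj
    have key := charFun_map_sum_mul (P := P) (X := fun ω (i : Fin n) => u ω i)
      (e := fun i : Fin n => e i) (v := v) (measurable_pi_lambda _ fun i => hu i)
      (fun i => he i) (hpair'.comp (fun _ => Prod.snd) fun _ => measurable_snd)
      (fun i => hgauss i)
      (indepFun_tuples (X := fun (i : Fin n) ω => u ω i) (fun i => hu i) (fun i => he i) hpair'
        fun i => hexog i)
      (c := fun p (i : Fin n) => errorCoef l (extend p) n i / √v)
      (measurable_pi_lambda _ fun i => (measurable_errorCoef hext l n i).div_const _) r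
    simp only [hcoef] at key
    simp only [Finset.sum_range]
    exact key
  have hlim : charFun (gaussianReal 0 1) r
      = ∫ _ : Ω, Complex.exp (-(r ^ 2) / 2 : ℝ) ∂P := by
    rw [charFun_gaussianReal, integral_const, probReal_univ, one_smul]
    congr 1
    push_cast
    ring
  rw [hlim]
  refine Tendsto.congr (fun n => (hchar n).symm) ?_
  -- The integrand is bounded by one and almost surely equals its limit from some `n` on, namely
  -- once the Gram matrix is positive definite.
  refine tendsto_integral_of_dominated_convergence (fun _ => 1) (fun n => ?_)
    (integrable_const _) (fun n => ae_of_all _ fun ω => ?_) ?_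
  · refine Measurable.aestronglyMeasurable ?_
    exact Complex.measurable_exp.comp (Complex.measurable_ofReal.comp
      (((Finset.measurable_sum _ fun t _ => (hcm n t).pow_const 2).const_mul _).neg.div_const _))
  · rw [Complex.norm_exp_ofReal, Real.exp_le_one_iff]
    have : 0 ≤ v * r ^ 2 * ∑ t ∈ Finset.range n, (errorCoef l (u ω) n t / √v) ^ 2 :=
      mul_nonneg (by positivity) (Finset.sum_nonneg fun _ _ => sq_nonneg _)
    linarith
  · filter_upwards [hG] with ω hω
    refine tendsto_const_nhds.congr' ?_
    filter_upwards [hω] with n hn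
    simp only [div_pow, Real.sq_sqrt hv'.le, ← Finset.sum_div, sum_errorCoef_sq hn hl]
    congr 3
    field_simp

end Asymptotics

/-! ### Laws of large numbers for the regression sums -/

section Main

variable {q₁ q₂ : ℕ} {Ω : Type*} [MeasurableSpace Ω] {P : Measure Ω} [IsProbabilityMeasure P]

section LawOfLargeNumbers

variable {u : Ω → ℕ → Idx q₁ q₂ → ℝ} {e : ℕ → Ω → ℝ} {v : ℝ≥0}

lemma ae_tendsto_gram (hu : ∀ t, Measurable fun ω => u ω t) (he : ∀ t, Measurable (e t))
    (hpair : iIndepFun (fun t ω => (u ω t, e t ω)) P)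
    (hexog : ∀ t, IndepFun (fun ω => u ω t) (e t) P)
    (hident : ∀ t, IdentDistrib (fun ω => u ω t) (fun ω => u ω 0) P P)
    (hgauss : ∀ t, HasLaw (e t) (gaussianReal 0 v) P)
    (hu2 : ∀ i, MemLp (fun ω => u ω 0 i) 2 P) :
    ∀ᵐ ω ∂P, Tendsto (fun n : ℕ => (n : ℝ)⁻¹ • gram (u ω) n) atTop
      (𝓝 (Matrix.of fun i j => ∫ ω, u ω 0 i * u ω 0 j ∂P)) := by
  have h : ∀ i j, ∀ᵐ ω ∂P, Tendsto (fun n : ℕ => (∑ t ∈ Finset.range n, u ω t i * u ω t j) / n)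
      atTop (𝓝 (∫ ω, u ω 0 i * u ω 0 j ∂P)) := fun i j =>
    strong_law_pairs (X := fun t ω => u ω t) hu he hpair hexog hident
      (fun t => (hgauss t).identDistrib (hgauss 0))
      (f := fun p => p.1 i * p.1 j) (measurable_fst.eval.mul measurable_fst.eval)
      ((hu2 i).integrable_mul (hu2 j))
  filter_upwards [ae_all_iff.2 fun i => ae_all_iff.2 (h i)] with ω hω
  refine tendsto_pi_nhds.2 fun i => tendsto_pi_nhds.2 fun j => (hω i j).congr fun n => ?_
  simp only [gram, Matrix.smul_apply, Matrix.sum_apply, vecMulVec_apply, smul_eq_mul]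
  rw [div_eq_inv_mul]

lemma ae_tendsto_errorSum (hu : ∀ t, Measurable fun ω => u ω t) (he : ∀ t, Measurable (e t))
    (hpair : iIndepFun (fun t ω => (u ω t, e t ω)) P)
    (hexog : ∀ t, IndepFun (fun ω => u ω t) (e t) P)
    (hident : ∀ t, IdentDistrib (fun ω => u ω t) (fun ω => u ω 0) P P)
    (hgauss : ∀ t, HasLaw (e t) (gaussianReal 0 v) P)
    (hu2 : ∀ i, MemLp (fun ω => u ω 0 i) 2 P) :
    ∀ᵐ ω ∂P, Tendsto (fun n : ℕ => (n : ℝ)⁻¹ • errorSum (u ω) (fun t => e t ω) n) atTop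
      (𝓝 0) := by
  have hmean : ∫ ω, e 0 ω ∂P = 0 := by
    rw [(hgauss 0).integral_eq, integral_id_gaussianReal]
  have he2 : MemLp (e 0) 2 P := by
    have := memLp_id_gaussianReal (μ := 0) (v := v) 2
    rw [← (hgauss 0).map_eq] at this
    exact (memLp_map_measure_iff aestronglyMeasurable_id (he 0).aemeasurable).1 this
  have h : ∀ i, ∀ᵐ ω ∂P, Tendsto (fun n : ℕ => (∑ t ∈ Finset.range n, e t ω * u ω t i) / n)
      atTop (𝓝 0) := fun i => by
    have hind : IndepFun (e 0) (fun ω => u ω 0 i) P :=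
      ((hexog 0).comp (φ := fun x : Idx q₁ q₂ → ℝ => x i) (measurable_pi_apply i)
        measurable_id).symm
    -- Independence of error and regressor factorises the mean, and the error is centred.
    have hzero : ∫ ω, e 0 ω * u ω 0 i ∂P = 0 := by
      rw [hind.integral_fun_mul_eq_mul_integral (he 0).aestronglyMeasurable
        (hu 0).eval.aestronglyMeasurable, hmean, zero_mul]
    have := strong_law_pairs (X := fun t ω => u ω t) hu he hpair hexog hident
      (fun t => (hgauss t).identDistrib (hgauss 0))
      (f := fun p => p.2 * p.1 i) (measurable_snd.mul measurable_fst.eval)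
      (he2.integrable_mul (hu2 i))
    rwa [hzero] at this
  filter_upwards [ae_all_iff.2 h] with ω hω
  refine tendsto_pi_nhds.2 fun i => (hω i).congr fun n => ?_
  simp only [errorSum, Pi.smul_apply, Finset.sum_apply, smul_eq_mul]
  rw [div_eq_inv_mul]

omit [IsProbabilityMeasure P] in
lemma ae_tendsto_mean_sq (he : ∀ t, Measurable (e t)) (hind : iIndepFun e P)
    (hgauss : ∀ t, HasLaw (e t) (gaussianReal 0 v) P) :
    ∀ᵐ ω ∂P, Tendsto (fun n : ℕ => (∑ t ∈ Finset.range n, e t ω ^ 2) / n) atTop (𝓝 v) := by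
  have he2 : MemLp (e 0) 2 P := by
    have := memLp_id_gaussianReal (μ := 0) (v := v) 2
    rw [← (hgauss 0).map_eq] at this
    exact (memLp_map_measure_iff aestronglyMeasurable_id (he 0).aemeasurable).1 this
  have hvar : ∫ ω, e 0 ω ^ 2 ∂P = v := by
    have hmean : ∫ ω, e 0 ω ∂P = 0 := by
      rw [(hgauss 0).integral_eq, integral_id_gaussianReal]
    rw [← variance_of_integral_eq_zero (he 0).aemeasurable hmean, (hgauss 0).variance_eq,
      variance_id_gaussianReal]
  rw [← hvar]
  refine strong_law_ae_real (fun t ω => e t ω ^ 2) he2.integrable_sq (fun s t hst => ?_) fun t => ?_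
  · exact (hind.indepFun hst).comp (measurable_id.pow_const 2) (measurable_id.pow_const 2)
  · exact ((hgauss t).identDistrib (hgauss 0)).sq

end LawOfLargeNumbers

end Main

end FMA

/-! ### Asymptotic normality and coverage -/

theorem mainTheorem8 {Ω : Type*} [MeasurableSpace Ω] (P : Measure Ω) [IsProbabilityMeasure P]
    {q₁ q₂ M : ℕ} (hM : 0 < M)
    -- regressors and errors
    (x : ℕ → Ω → Fin q₁ → ℝ) (z : ℕ → Ω → Fin q₂ → ℝ) (e : ℕ → Ω → ℝ) (σ2 : ℝ≥0) (hσ : 0 < σ2)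
    (hx : ∀ t, Measurable (x t)) (hz : ∀ t, Measurable (z t)) (he : ∀ t, Measurable (e t))
    (hindep : iIndepFun (fun t ω => (x t ω, z t ω, e t ω)) P)
    (hident : ∀ t, IdentDistrib (fun ω => (x t ω, z t ω)) (fun ω => (x 0 ω, z 0 ω)) P P)
    (hexog : ∀ t, IndepFun (fun ω => (x t ω, z t ω)) (e t) P)
    (hgauss : ∀ t, HasLaw (e t) (gaussianReal 0 σ2) P)
    (hx2 : ∀ i, MemLp (fun ω => x 0 ω i) 2 P) (hz2 : ∀ j, MemLp (fun ω => z 0 ω j) 2 P)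
    (u : Ω → ℕ → FMA.Idx q₁ q₂ → ℝ)
    (hu : u = fun ω => FMA.regressor (fun t => x t ω) (fun t => z t ω))
    (hJ : (FMA.fisherInfo P σ2 (fun ω => u ω 0)).PosDef)
    -- the fixed true parameter `θ₀ = (β₀, δ')`, the responses and the focus `aᵀ β + bᵀ γ`
    (θ₀ : FMA.Idx q₁ q₂ → ℝ)
    (y : Ω → ℕ → ℝ) (hy : y = fun ω => FMA.response (u ω) θ₀ (fun t => e t ω))
    (a : Fin q₁ → ℝ) (b : Fin q₂ → ℝ) (hab : a ≠ 0 ∨ b ≠ 0)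
    -- the candidate models and the maximum likelihood estimators
    (S : Fin M → Finset (Fin q₂))
    (est : ℕ → Ω → Finset (Fin q₂) → FMA.Idx q₁ q₂ → ℝ)
    (hest : ∀ n A, Measurable (fun ω => est n ω A))
    (hmle : ∀ n A, ∀ᵐ ω ∂P, FMA.IsMLE σ2 (u ω) (y ω) n A (est n ω A))
    -- the error variance used in `Ĵ`: any consistent estimator (for example `σ²` itself, if it
    -- is known), or the maximum likelihood estimator
    (s : ℕ → Ω → ℝ≥0)
    (hs : ((∀ n, Measurable (s n)) ∧ TendstoInMeasure P s atTop (fun _ => σ2)) ∨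
      s = fun n ω => FMA.residualVar (u ω) (y ω) n (est n ω Finset.univ))
    -- the weights: any random weights in the simplex, or S-AIC, or S-BIC weights
    (w : ℕ → Ω → Fin M → ℝ)
    (hw : ((∀ n, Measurable (w n)) ∧ ∀ n ω, w n ω ∈ stdSimplex ℝ (Fin M)) ∨
      (w = fun n ω => FMA.icWeight 2 (s n ω) (u ω) (y ω) n (est n ω) S) ∨
      (w = fun (n : ℕ) ω => FMA.icWeight (Real.log n) (s n ω) (u ω) (y ω) n (est n ω) S)) :
    TendstoInDistribution
      (fun n ω => FMA.tStat (FMA.sampleInfo (s n ω) (u ω) n) a b S (w n ω) n (est n ω) θ₀)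
      atTop id (fun _ => P) (gaussianReal 0 1) ∧
    ∀ α : ℝ, 0 < α → α < 1 →
      Tendsto
        (fun n => P.real {ω | FMA.focus a b θ₀ ∈
          FMA.confInt (FMA.sampleInfo (s n ω) (u ω) n) a b S (w n ω) n (est n ω) α})
        atTop (𝓝 (1 - α)) := by
  have hum : ∀ t, Measurable fun ω => u ω t := by
    intro t
    rw [hu]
    refine measurable_pi_iff.2 ?_
    rintro (i | j)
    · exact (hx t).eval
    · exact (hz t).eval
  have hym : ∀ t, Measurable fun ω => y ω t := by
    intro t
    rw [hy]
    exact (FMA.measurable_dotProduct (w := fun _ => θ₀) (fun _ => (hum t).eval)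
      fun _ => measurable_const).add (he t)
  let pack : (Fin q₁ → ℝ) × (Fin q₂ → ℝ) → FMA.Idx q₁ q₂ → ℝ := fun p => Sum.elim p.1 p.2
  have hpack : Measurable pack := by
    refine measurable_pi_iff.2 ?_
    rintro (i | j)
    · exact measurable_fst.eval
    · exact measurable_snd.eval
  have hpair : iIndepFun (fun t ω => (u ω t, e t ω)) P := by
    rw [hu]
    exact hindep.comp (fun _ p => (pack (p.1, p.2.1), p.2.2)) fun _ =>
      (hpack.comp (measurable_fst.prodMk measurable_snd.fst)).prodMk measurable_snd.snd
  have hexog' : ∀ t, IndepFun (fun ω => u ω t) (e t) P := by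
    rw [hu]
    exact fun t => (hexog t).comp hpack measurable_id
  have hident' : ∀ t, IdentDistrib (fun ω => u ω t) (fun ω => u ω 0) P P := by
    rw [hu]
    exact fun t => (hident t).comp hpack
  have hu2 : ∀ i, MemLp (fun ω => u ω 0 i) 2 P := by
    rw [hu]
    rintro (i | j)
    · exact hx2 i
    · exact hz2 j
  set A : Matrix (FMA.Idx q₁ q₂) (FMA.Idx q₁ q₂) ℝ :=
    Matrix.of fun i j => ∫ ω, u ω 0 i * u ω 0 j ∂P with hAdef
  have hσ' : (0 : ℝ) < σ2 := hσ
  have hA : A.PosDef := by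
    have : A = (σ2 : ℝ) • FMA.fisherInfo P σ2 fun ω => u ω 0 := by
      ext i j
      simp only [hAdef, FMA.fisherInfo, Matrix.smul_apply, Matrix.of_apply, smul_eq_mul]
      rw [mul_inv_cancel_left₀ hσ'.ne']
    rw [this]
    exact hJ.smul hσ'
  have hgram := FMA.ae_tendsto_gram hum he hpair hexog' hident' hgauss hu2
  have hPD : ∀ᵐ ω ∂P, ∀ᶠ n in atTop, (FMA.gram (u ω) n).PosDef :=
    hgram.mono fun ω hω => FMA.eventually_gram_posDef hA hω
  have hmle' : ∀ n, ∀ᵐ ω ∂P, ∀ B, FMA.IsMLE σ2 (u ω) (FMA.response (u ω) θ₀ fun t => e t ω) n B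
      (est n ω B) := by
    intro n
    rw [hy] at hmle
    exact ae_all_iff.2 (hmle n)
  have hsm : ∀ n, Measurable (s n) := by
    rcases hs with hs | hs
    · exact hs.1
    · rw [hs]
      exact fun n => FMA.measurable_residualVar hum hym (hest n _) n
  have hst : TendstoInMeasure P s atTop fun _ => σ2 := by
    rcases hs with hs | hs
    · exact hs.2
    · refine tendstoInMeasure_of_tendsto_ae (fun n => (hsm n).aestronglyMeasurable) ?_
      filter_upwards [hgram, FMA.ae_tendsto_errorSum hum he hpair hexog' hident' hgauss hu2,
        FMA.ae_tendsto_mean_sq he (hpair.comp (fun _ => Prod.snd) fun _ => measurable_snd) hgauss,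
        ae_all_iff.2 hmle'] with ω h1 h2 h3 h4
      rw [hs, hy]
      exact FMA.tendsto_residualVar hσ hA h1 h2 h3 fun n => h4 n _
  have hwm : ∀ n, Measurable (w n) := by
    rcases hw with hw | hw | hw
    · exact hw.1
    · rw [hw]
      exact fun n => FMA.measurable_icWeight (hsm n) hum hym (hest n) _ n S
    · rw [hw]
      exact fun n => FMA.measurable_icWeight (hsm n) hum hym (hest n) _ n S
  have hw1 : ∀ n ω, ∑ m, w n ω m = 1 := by
    intro n ω
    rcases hw with hw | hw | hw
    · exact (hw.2 n ω).2
    · rw [hw]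
      exact FMA.sum_icWeight hM _ _ _ _ _ _ _
    · rw [hw]
      exact FMA.sum_icWeight hM _ _ _ _ _ _ _
  have hl : (Sum.elim a b : FMA.Idx q₁ q₂ → ℝ) ≠ 0 := by
    intro h
    rcases hab with ha | hb
    · exact ha (funext fun i => congrFun h (Sum.inl i))
    · exact hb (funext fun j => congrFun h (Sum.inr j))
  -- outside an event of vanishing probability, the statistic is a normalised sum of the errors
  let bad : ℕ → Set Ω := fun n => {ω | ¬ (0 < n ∧ 0 < s n ω ∧ (FMA.gram (u ω) n).PosDef ∧
    ∀ B, FMA.IsMLE σ2 (u ω) (FMA.response (u ω) θ₀ fun t => e t ω) n B (est n ω B))}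
  -- For `n > 0` the bad event lies, up to a null set, in the union of `s n = 0` and `det (G/n) =
  -- 0`. Both quantities converge in probability to nonzero limits, so they take the value zero with
  -- vanishing probability.
  have hbad : Tendsto (fun n => P (bad n)) atTop (𝓝 0) := by
    have h1 := FMA.tendsto_measure_eq_of_tendstoInMeasure hσ.ne hst
    have hdet : TendstoInMeasure P (fun (n : ℕ) ω => ((n : ℝ)⁻¹ • FMA.gram (u ω) n).det) atTop
        fun _ => A.det := by
      refine tendstoInMeasure_of_tendsto_ae (fun n => ?_)
        (hgram.mono fun ω hω => (continuous_id.matrix_det.tendsto A).comp hω)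
      exact (FMA.measurable_det (A := fun ω => (n : ℝ)⁻¹ • FMA.gram (u ω) n) fun i j =>
        (FMA.measurable_gram_entry hum n i j).const_mul (n : ℝ)⁻¹).aestronglyMeasurable
    have h2 := FMA.tendsto_measure_eq_of_tendstoInMeasure
      (hA.posSemidef.posDef_iff_det_ne_zero.1 hA).symm hdet
    have h12 := h1.add h2
    rw [zero_add] at h12
    refine tendsto_of_tendsto_of_tendsto_of_le_of_le' tendsto_const_nhds h12
      (Eventually.of_forall fun _ => zero_le) ?_
    filter_upwards [eventually_gt_atTop 0] with n hn
    refine le_trans (measure_mono_ae ?_) (measure_union_le _ _)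
    filter_upwards [hmle' n] with ω hω hb
    by_contra hcon
    refine hb ⟨hn, pos_iff_ne_zero.2 fun h => hcon (Or.inl h), ?_, hω⟩
    refine (FMA.gram_posSemidef _ n).posDef_iff_det_ne_zero.2 fun h => hcon (Or.inr ?_)
    rw [Set.mem_ofPred_eq, det_smul, h, mul_zero]
  have hT : ∀ n, ∀ ω ∉ bad n,
      FMA.tStat (FMA.sampleInfo (s n ω) (u ω) n) a b S (w n ω) n (est n ω) θ₀
        = (∑ t ∈ Finset.range n, FMA.errorCoef (Sum.elim a b) (u ω) n t / √σ2 * e t ω)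
          * (√σ2 / √(s n ω)) := by
    intro n ω hω
    obtain ⟨h0, hs0, hG, hm⟩ := not_not.1 hω
    have hne : √(σ2 : ℝ) ≠ 0 := by positivity
    rw [FMA.tStat_eq hσ hs0 h0 hG a b S (hw1 n ω) hm, Finset.sum_mul, Finset.sum_div]
    refine Finset.sum_congr rfl fun t _ => ?_
    field_simp
  have hTm : ∀ n, Measurable fun ω =>
      FMA.tStat (FMA.sampleInfo (s n ω) (u ω) n) a b S (w n ω) n (est n ω) θ₀ :=
    fun n => FMA.measurable_tStat (hsm n) hum (hwm n) (hest n) a b S n θ₀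
  have hratio : ∀ n, Measurable fun ω => √(σ2 : ℝ) / √(s n ω : ℝ) := fun n =>
    measurable_const.div (hsm n).coe_nnreal_real.sqrt
  have hratio_lim : TendstoInMeasure P (fun n ω => √(σ2 : ℝ) / √(s n ω : ℝ)) atTop fun _ => 1 := by
    have hcont : ContinuousAt (fun v : ℝ≥0 => √(σ2 : ℝ) / √(v : ℝ)) σ2 :=
      continuousAt_const.div (NNReal.continuous_coe.sqrt).continuousAt (by positivity)
    have := FMA.tendstoInMeasure_comp_continuousAt hst hcont
      fun n => (hratio n).aestronglyMeasurable
    rwa [div_self (by positivity)] at this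
  have hZ := FMA.tendstoInDistribution_errorCoef hσ hum he hpair hexog' hgauss hPD hl
  -- Slutsky's lemma, with the factor `σ/σ̂` tending to one in probability.
  have hZr := hZ.continuous_comp_prodMk_of_tendstoInMeasure_const
    (g := fun p : ℝ × ℝ => p.1 * p.2) (by fun_prop) hratio_lim fun n => (hratio n).aemeasurable
  simp only [mul_one] at hZr
  have hdist : TendstoInDistribution
      (fun n ω => FMA.tStat (FMA.sampleInfo (s n ω) (u ω) n) a b S (w n ω) n (est n ω) θ₀)
      atTop id (fun _ => P) (gaussianReal 0 1) :=
    tendstoInDistribution_of_tendstoInMeasure_sub _ _ hZr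
      (FMA.tendstoInMeasure_sub_of_eq hbad hT) fun n => (hTm n).aemeasurable
  refine ⟨hdist, fun α hα0 hα1 => ?_⟩
  set I := Set.Icc (-FMA.normalQuantile (1 - α / 2)) (FMA.normalQuantile (1 - α / 2)) with hI
  have hna : NullSingletonClass (gaussianReal 0 1) := nullSingletonClass_gaussianReal one_ne_zero
  have hcover : Tendsto (fun n => P.real {ω | FMA.tStat (FMA.sampleInfo (s n ω) (u ω) n) a b S
      (w n ω) n (est n ω) θ₀ ∈ I}) atTop (𝓝 (1 - α)) := by
    -- The frontier lies in the two end points, which carry no Gaussian mass, so the portmanteau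
    -- theorem applies.
    have hfr : (gaussianReal 0 1) (frontier I) = 0 := by
      refine measure_mono_null (t := {-FMA.normalQuantile (1 - α / 2),
        FMA.normalQuantile (1 - α / 2)}) ?_ ((Set.toFinite _).measure_zero _)
      rw [hI, isClosed_Icc.frontier_eq, interior_Icc]
      intro r hr
      rcases hr.1.1.eq_or_lt with h | h
      · exact Or.inl h.symm
      · exact Or.inr (hr.1.2.eq_or_lt.resolve_right fun h' => hr.2 ⟨h, h'⟩)
    have hport : Tendsto (fun n => (P.map fun ω => FMA.tStat (FMA.sampleInfo (s n ω) (u ω) n) a b S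
        (w n ω) n (est n ω) θ₀) I) atTop (𝓝 ((gaussianReal 0 1).map id I)) :=
      ProbabilityMeasure.tendsto_measure_of_null_frontier_of_tendsto' hdist.tendsto
        (by simpa using hfr)
    rw [Measure.map_id] at hport
    rw [← FMA.gaussianReal_Icc_normalQuantile hα0 hα1]
    refine ((ENNReal.tendsto_toReal (measure_ne_top _ _)).comp hport).congr fun n => ?_
    rw [Function.comp_apply, Measure.map_apply (hTm n) measurableSet_Icc]
    rfl
  -- Off the bad event `φ̂ > 0`, so the coverage event coincides with `T_n ∈ I`.
  refine FMA.tendsto_measureReal_of_iff hbad (fun n ω hω => ?_) hcover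
  obtain ⟨h0, hs0, hG, -⟩ := not_not.1 hω
  refine (FMA.mem_confInt_iff ?_ h0 S (w n ω) (est n ω) α).symm
  have hs0' : (0 : ℝ) < s n ω := hs0
  have hpos := FMA.dotProduct_inv_mulVec_pos hG hl
  rw [FMA.scalePhi_sampleInfo hs0 h0 hG]
  positivity
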